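/- Let \(E\) be a countable set with the discrete metric \(d(x,y)=\mathbf 1\{x\ne y\}\), and let \((X_n)_{n\in\mathbb Z}\) be a two-sided stationary Markov chain on \(E\) with transition probabilities \(p(x,y)\) and stationary distribution \(\nu\). Let \(\mathbb P\) be its law on \(E^{\mathbb Z}\), with expectation \(\mathbb E\), and assume that \(\mathbb P\) is tail trivial: every event in \(\bigcap_{i\in\mathbb Z}\sigma(X_k:k\le i)\) has probability \(0\) or \(1\). For \(x,y\in E\) let \(\hat{\mathbb P}_{x,y}\), with expectation \(\hat{\mathbb E}_{x,y}\), be a coupling on \(E^{\mathbb N}\times E^{\mathbb N}\) of the laws of the chains \((X_n)_{n\ge 0}\) with transition probabilities \(p\) started at time \(0\) from \(x\) and from \(y\) (for instance a Markovian coupling), and let \[T(u,v)=\inf\{k\ge 0:\ u_j=v_j\text{ for all }j\ge k\}\in\{0,1,2,\dots\}\cup\{\infty\}\] be the coupling time. For \(f:E^{\mathbb Z}\to\mathbb R\) and \(i\in\mathbb Z\) put \[\delta_i(f)=\sup\Big\{\tfrac{f(\bar x)-f(\bar y)}{d(x_i,y_i)}:\ x_j=y_j\ \forall j\ne i,\ x_i\ne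 y_i\Big\},\qquad \|\delta(f)\|_2=\Big(\sum_{i\in\mathbb Z}\delta_i(f)^2\Big)^{1/2}\in[0,\infty].\] Let \(p\ge 1\) be an integer, and let \(f:E^{\mathbb Z}\to\mathbb R\) be measurable with \(\delta_i(f)<\infty\) for all \(i\in\mathbb Z\) and \(f\in L^{2p}(\mathbb P)\). Then for every \(\epsilon>0\) \[\mathbb E\big[(f-\mathbb E f)^{2p}\big]\le C_p\,\|\delta(f)\|_2^{2p},\] where, with \(\zeta(s)=\sum_{n\ge1}n^{-s}\), \[C_p=(2p-1)^{2p}\Big(\frac{\zeta(1+\epsilon)}{2}\Big)^p\sum_{x,y\in E}\nu(x)\,p(x,y)\Big(\sum_{z\in E}p(x,z)\,\hat{\mathbb E}_{y,z}\big[(T+1)^{1+\epsilon/2}\big]\Big)^{2p}\in(0,\infty].\] Consequently, for all \(t>0\), \[\mathbb P(|f-\mathbb E f|\ge t)\le C_p\,\frac{\|\delta(f)\|_2^{2p}}{t^{2p}}.\] (All quantities on the right-hand sides take values in \([0,\infty]\), with \(0\cdot\infty=0\).) -/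

import Mathlib

open MeasureTheory ProbabilityTheory
open scoped ENNReal

namespace MarkovConcentration

/-- The `i`-th Lipschitz constant of a function `f` of two-sided sequences: the supremum of
`(f x - f y) / d (x i, y i)` over sequences `x`, `y` that differ exactly at `i`. Exchanging `x` and
`y` changes the sign, so cutting negative quotients off at `0` does not change the supremum
(for a one-point space the supremum over no pairs is `0`). -/
noncomputable def lipConst {E : Type*} [MetricSpace E] (f : (ℤ → E) → ℝ) (i : ℤ) : ℝ≥0∞ :=
  ⨆ (x : ℤ → E) (y : ℤ → E) (_ : ∀ j, j ≠ i → x j = y j) (_ : x i ≠ y i),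
    ENNReal.ofReal ((f x - f y) / dist (x i) (y i))

/-- `f` is Lipschitz in all coordinates. -/
def IsLipCoord {E : Type*} [MetricSpace E] (f : (ℤ → E) → ℝ) : Prop :=
  ∀ i, lipConst f i < ∞

/-- The `ℓ²` norm of a nonnegative, possibly infinite, sequence indexed by `ℤ`. -/
noncomputable def l2norm (a : ℤ → ℝ≥0∞) : ℝ≥0∞ :=
  (∑' i, a i ^ 2) ^ (1 / 2 : ℝ)

/-- `Q` is the law on `E^ℕ` of the Markov chain `(X_n)_{n ≥ 0}` on the countable space `E` with
transition kernel `κ` and initial distribution `μ`: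
`Q (X_0 = w_0, …, X_n = w_n) = μ(w_0) κ(w_0, w_1) ⋯ κ(w_{n-1}, w_n)`. -/
def IsMarkovLaw {E : Type*} [MeasurableSpace E] (κ : Kernel E E) (μ : Measure E)
    (Q : Measure (ℕ → E)) : Prop :=
  ∀ (n : ℕ) (w : ℕ → E),
    Q {u | ∀ k ≤ n, u k = w k} = μ {w 0} * ∏ k ∈ Finset.range n, κ (w k) {w (k + 1)}

/-- `P` is the law on `E^ℤ` of the two-sided stationary Markov chain with transition kernel `κ`
and stationary distribution `ν`: it is invariant under the shift, and the coordinates with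
nonnegative index form a Markov chain with kernel `κ` and initial distribution `ν`. -/
structure IsStationaryMarkov {E : Type*} [MeasurableSpace E] (κ : Kernel E E) (ν : Measure E)
    (P : Measure (ℤ → E)) : Prop where
  stationary : P.map (fun (x : ℤ → E) (n : ℤ) => x (n + 1)) = P
  markov : IsMarkovLaw κ ν (P.map (fun (x : ℤ → E) (n : ℕ) => x (n : ℤ)))

/-- The sigma-field generated by the coordinates `X_k`, `k ≤ i`. -/
abbrev pastSigma (E : Type*) [MeasurableSpace E] (i : ℤ) : MeasurableSpace (ℤ → E) :=
  ⨆ (k : ℤ) (_ : k ≤ i), MeasurableSpace.comap (fun x : ℤ → E => x k) inferInstance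

/-- The tail sigma-field: the intersection over `i` of the sigma-fields of the past up to `i`. -/
abbrev tailSigma (E : Type*) [MeasurableSpace E] : MeasurableSpace (ℤ → E) :=
  ⨅ i : ℤ, pastSigma E i

/-- `P` is tail trivial. -/
def IsTailTrivial {E : Type*} [MeasurableSpace E] (P : Measure (ℤ → E)) : Prop :=
  ∀ A : Set (ℤ → E), MeasurableSet[tailSigma E] A → P A = 0 ∨ P A = 1

/-- `Phat x y` is, for all `x`, `y`, a coupling of the laws of the Markov chains with kernel `κ`
started at time `0` from `x` and from `y`. -/
structure IsChainCoupling {E : Type*} [MeasurableSpace E] (κ : Kernel E E)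
    (Phat : E → E → Measure ((ℕ → E) × (ℕ → E))) : Prop where
  left : ∀ x y, IsMarkovLaw κ (Measure.dirac x) ((Phat x y).map Prod.fst)
  right : ∀ x y, IsMarkovLaw κ (Measure.dirac y) ((Phat x y).map Prod.snd)

/-- The coupling time `T(u, v) = inf {k ≥ 0 : u_j = v_j for all j ≥ k}`, which is `∞` if there is
no such `k`. -/
noncomputable def couplingTime {E : Type*} (w : (ℕ → E) × (ℕ → E)) : ℕ∞ :=
  ⨅ (k : ℕ) (_ : ∀ j, k ≤ j → w.1 j = w.2 j), (k : ℕ∞)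

/-- The expectation of `(T + 1) ^ (1 + ε / 2)` under the coupling started from `(y, z)`. -/
noncomputable def couplingMoment {E : Type*} [MeasurableSpace E]
    (Phat : E → E → Measure ((ℕ → E) × (ℕ → E))) (ε : ℝ) (y z : E) : ℝ≥0∞ :=
  ∫⁻ w, (((couplingTime w : ℕ∞) : ℝ≥0∞) + 1) ^ (1 + ε / 2) ∂(Phat y z)

/-- `ζ(s) = ∑_{n ≥ 1} (1 / n) ^ s`, as a sum of nonnegative terms. -/
noncomputable def zetaSum (s : ℝ) : ℝ≥0∞ :=
  ∑' n : ℕ, (1 / ((n : ℝ≥0∞) + 1)) ^ s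

/-- The constant `C_p`, possibly infinite. -/
noncomputable def momentConst {E : Type*} [MeasurableSpace E] (κ : Kernel E E) (ν : Measure E)
    (Phat : E → E → Measure ((ℕ → E) × (ℕ → E))) (ε : ℝ) (p : ℕ) : ℝ≥0∞ :=
  ENNReal.ofReal ((2 * (p : ℝ) - 1) ^ (2 * p)) * (zetaSum (1 + ε) / 2) ^ p *
    ∑' (x : E) (y : E), ν {x} * κ x {y} *
      (∑' z : E, κ x {z} * couplingMoment Phat ε y z) ^ (2 * p)

end MarkovConcentration

/-!
The fluctuation `f - 𝔼 f` is decomposed into martingale increments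
`Δ_i = 𝔼[f | X_k, k ≤ i] - 𝔼[f | X_k, k < i]`. Two facts are needed: a pointwise bound on `Δ_i`
coming from the coupling, and a moment inequality for martingales.

*Increments.* By the Markov property (`IsStationaryMarkov.condExp_self`,
`IsStationaryMarkov.condExp_pred`), `Δ_i` compares the average of `f` over the chain restarted from
`X_i` with its average over the chain restarted after one fresh jump from `X_{i-1}`, the past before
time `i` being kept (`glue`). Realizing both on one space through the coupling
(`condExp_sub_eq_integral`), the two trajectories differ only at the times `i + k` with `k < T`, so
that `|Δ_i| ≤ ∑ k, δ_{i+k}(f) ρ(k < T)`, where `ρ` is the coupling. Cauchy–Schwarz with the weights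
`(k + 1) ^ (1 + ε)`, and `∑ k, (k + 1) ^ (1 + ε) ρ(k < T)² ≤ ½ (ρ[(T + 1) ^ (1 + ε / 2)])²`, which is
seen by writing the square as an expectation over two independent copies of `T`
(`tsum_measure_sq_le`), give
`Δ_i² ≤ ½ K(X_{i-1}, X_i)² ∑ k, δ_{i+k}(f)² (k + 1) ^ (-(1 + ε))`, with `K` the `jumpMoment`.
Summing over `i` produces `ζ(1 + ε) ‖δ(f)‖₂²`.

*Moments.* In place of Burkholder's inequality for the square function, the proof uses the recursion
`‖X + Y‖² ≤ ‖X‖² + (2p - 1)² ‖Y‖²` in `L^{2p}`, valid when `Y` has conditional mean zero given a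
sigma-field for which `X` is measurable (`moment_add_le`). It follows from the pointwise inequality
`(x + y)^{2p} ≤ 2p x^{2p-1} y + (x² + (2p - 1)² y²)^p` and Minkowski's inequality in `L^p`. Since the
bound on `Δ_i` is a deterministic sequence times a function of `(X_{i-1}, X_i)`, whose law does not
depend on `i`, summing the squared `L^{2p}` norms of the increments is enough.

*Limits.* `𝔼[f | X_k, k ≤ n] → f` by Lévy's upward theorem, and `𝔼[f | X_k, k ≤ -n] → 𝔼 f` in `L²` by
tail triviality; Fatou's lemma concludes.

*The degenerate case.* If the constant is infinite while `δ(f) = 0`, the right-hand side vanishes,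
and one has to show that `f` is almost surely constant although the given coupling may fail. Tail
triviality makes the chain mixing (`IsTailTrivial.tendsto_measure_pair`), hence bounded functions of
the remote future have the same expectation from all initial states
(`IsTailTrivial.integral_eq_of_remote`), and all increments vanish.
-/

namespace MarkovConcentration

open Filter Topology

/-! ### Moments of martingales with even exponent -/

/-- The even and the odd part in `y` of `(x + y) ^ (2 (q + 1))` are bounded jointly, since
multiplying by `(x + y) ^ 2` mixes them. -/
theorem even_odd_part_le {c x y : ℝ} (q : ℕ) (hc : 4 * (q : ℝ) + 1 ≤ c) (hx : 0 ≤ x)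
    (hy : 0 ≤ y) :
    ((x + y) ^ (2 * (q + 1)) + (x - y) ^ (2 * (q + 1))) / 2 ≤ (x ^ 2 + c * y ^ 2) ^ (q + 1) ∧
      ((x + y) ^ (2 * (q + 1)) - (x - y) ^ (2 * (q + 1))) / 2 ≤
        2 * (q + 1) * (x * y) * (x ^ 2 + c * y ^ 2) ^ q := by
  induction q with
  | zero =>
    have : 0 ≤ (c - 1) * y ^ 2 := mul_nonneg (by simpa using hc) (sq_nonneg y)
    constructor
    · simp; nlinarith
    · simp; nlinarith
  | succ q ih =>
    push_cast at hc
    obtain ⟨hE, hO⟩ := ih (by linarith)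
    have hq : (0 : ℝ) ≤ q := Nat.cast_nonneg q
    set W := x ^ 2 + c * y ^ 2 with hW
    have hc0 : 0 ≤ c := by linarith
    have hW0 : 0 ≤ W := by positivity
    have hxy : 0 ≤ x * y := mul_nonneg hx hy
    set A := (x + y) ^ (2 * (q + 1)) with hA
    set B := (x - y) ^ (2 * (q + 1)) with hB
    have hA' : (x + y) ^ (2 * (q + 1 + 1)) = (x + y) ^ 2 * A := by rw [hA]; ring
    have hB' : (x - y) ^ (2 * (q + 1 + 1)) = (x - y) ^ 2 * B := by rw [hB]; ring
    have hWq : 0 ≤ W ^ q := pow_nonneg hW0 q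
    have hWle : x ^ 2 + y ^ 2 ≤ W := by
      have : 0 ≤ (c - 1) * y ^ 2 := mul_nonneg (by linarith) (sq_nonneg y)
      rw [hW]; linarith
    rw [hA', hB']
    constructor
    · have e : ((x + y) ^ 2 * A + (x - y) ^ 2 * B) / 2
          = (x ^ 2 + y ^ 2) * ((A + B) / 2) + 2 * (x * y) * ((A - B) / 2) := by ring
      rw [e]
      calc _ ≤ (x ^ 2 + y ^ 2) * W ^ (q + 1) + 2 * (x * y) * (2 * (q + 1) * (x * y) * W ^ q) := by
            gcongr
        _ = W ^ q * ((x ^ 2 + y ^ 2) * W + 4 * (q + 1) * x ^ 2 * y ^ 2) := by ring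
        _ ≤ W ^ q * (W * W) := by
            gcongr
            have h1 : 4 * (q + 1 : ℝ) * x ^ 2 * y ^ 2 ≤ (c - 1) * y ^ 2 * W := by
              have h2 : 4 * (q + 1 : ℝ) * y ^ 2 ≤ (c - 1) * y ^ 2 := by gcongr; linarith
              have h3 : x ^ 2 ≤ W := by nlinarith [sq_nonneg y]
              calc 4 * (q + 1 : ℝ) * x ^ 2 * y ^ 2 = (4 * (q + 1 : ℝ) * y ^ 2) * x ^ 2 := by ring
                _ ≤ _ := by gcongr; exact le_trans (by positivity) h2
            have h4 : W * W = (x ^ 2 + y ^ 2) * W + (c - 1) * y ^ 2 * W := by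
              rw [hW]; ring
            linarith
        _ = W ^ (q + 1 + 1) := by ring
    · have e : ((x + y) ^ 2 * A - (x - y) ^ 2 * B) / 2
          = (x ^ 2 + y ^ 2) * ((A - B) / 2) + 2 * (x * y) * ((A + B) / 2) := by ring
      rw [e]
      calc _ ≤ (x ^ 2 + y ^ 2) * (2 * (q + 1) * (x * y) * W ^ q) + 2 * (x * y) * W ^ (q + 1) := by
            gcongr
        _ ≤ W * (2 * (q + 1) * (x * y) * W ^ q) + 2 * (x * y) * W ^ (q + 1) := by gcongr
        _ = _ := by push_cast; ring

theorem even_part_le {c : ℝ} (q : ℕ) (hc : 4 * (q : ℝ) + 1 ≤ c) (x y : ℝ) :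
    ((x + y) ^ (2 * (q + 1)) + (x - y) ^ (2 * (q + 1))) / 2 ≤ (x ^ 2 + c * y ^ 2) ^ (q + 1) := by
  have h := (even_odd_part_le q hc (abs_nonneg x) (abs_nonneg y)).1
  rw [sq_abs, sq_abs] at h
  refine le_trans (le_of_eq ?_) h
  have ev : Even (2 * (q + 1)) := even_two_mul _
  rcases abs_choice x with hx | hx <;> rcases abs_choice y with hy | hy <;> rw [hx, hy]
  · rw [← sub_eq_add_neg, sub_neg_eq_add, add_comm]
  · rw [show -x + y = -(x - y) by ring, show -x - y = -(x + y) by ring, ev.neg_pow, ev.neg_pow,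
      add_comm]
  · rw [show -x + -y = -(x + y) by ring, show -x - -y = -(x - y) by ring, ev.neg_pow, ev.neg_pow]

/-- Bernoulli's inequality for even exponents, in homogeneous form. -/
theorem pow_sub_le_sub_pow (p : ℕ) (x y : ℝ) :
    x ^ (2 * p) - 2 * p * x ^ (2 * p - 1) * y ≤ (x - y) ^ (2 * p) := by
  rcases Nat.eq_zero_or_pos p with rfl | hp
  · simp
  by_cases hx : x = 0
  · subst hx
    rw [zero_pow (by omega), zero_pow (by omega)]
    simpa using (even_two_mul p).pow_nonneg (-y)
  have key : 1 + (2 * p : ℕ) * (-(y / x)) ≤ (1 + -(y / x)) ^ (2 * p) := by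
    by_cases h : -2 ≤ -(y / x)
    · exact one_add_mul_le_pow h _
    · push Not at h
      refine le_trans ?_ ((even_two_mul p).pow_nonneg _)
      have : (1 : ℝ) ≤ (2 * p : ℕ) := by exact_mod_cast (by omega : 1 ≤ 2 * p)
      nlinarith
  have hxp : 0 ≤ x ^ (2 * p) := (even_two_mul p).pow_nonneg x
  have := mul_le_mul_of_nonneg_left key hxp
  rw [← mul_pow] at this
  have e1 : x * (1 + -(y / x)) = x - y := by field_simp; ring
  have e2 : x ^ (2 * p) * (1 + (2 * p : ℕ) * (-(y / x))) =
      x ^ (2 * p) - 2 * p * x ^ (2 * p - 1) * y := by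
    obtain ⟨k, hk⟩ : ∃ k, 2 * p = k + 1 := ⟨2 * p - 1, by omega⟩
    have hk' : (2 * p : ℝ) = k + 1 := by exact_mod_cast hk
    rw [hk, hk']; simp only [Nat.add_sub_cancel, pow_succ]; push_cast; field_simp; ring
  rw [e1, e2] at this
  exact this

/-- The pointwise inequality behind `moment_add_le`: `(x + y) ^ (2p)` is, up to its linear term
in `y`, at most `(x² + (2p - 1)² y²) ^ p`. -/
theorem add_pow_two_mul_le {p : ℕ} (hp : 1 ≤ p) (x y : ℝ) :
    (x + y) ^ (2 * p) ≤
      2 * p * x ^ (2 * p - 1) * y + (x ^ 2 + (2 * p - 1) ^ 2 * y ^ 2) ^ p := by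
  -- For `p ≥ 3` the constant `(2p - 1)² / 2` is large enough for `even_part_le`.
  obtain rfl | rfl | hp3 : p = 1 ∨ p = 2 ∨ 3 ≤ p := by omega
  · norm_num; nlinarith
  · norm_num; nlinarith [sq_nonneg (x * y), sq_nonneg (y * y), sq_nonneg (y * (x - y)),
      sq_nonneg (y * (x + y))]
  obtain ⟨q, rfl⟩ : ∃ q, p = q + 1 := ⟨p - 1, by omega⟩
  have hq : (2 : ℝ) ≤ q := by exact_mod_cast (by omega : 2 ≤ q)
  set s : ℝ := (2 * ((q + 1 : ℕ) : ℝ) - 1) ^ 2 with hs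
  have h1 := even_part_le (c := s / 2) q (by rw [hs]; push_cast; nlinarith) x y
  have h2 := pow_sub_le_sub_pow (q + 1) x y
  have hs0 : 0 ≤ s := sq_nonneg _
  -- Convexity of the power between `x²` and `x² + s y²` absorbs the term `x ^ (2p)` lost through
  -- Bernoulli's inequality.
  have h3 : (x ^ 2 + s / 2 * y ^ 2) ^ (q + 1) ≤
      (x ^ (2 * (q + 1)) + (x ^ 2 + s * y ^ 2) ^ (q + 1)) / 2 := by
    have := (convexOn_pow (𝕜 := ℝ) (q + 1)).2
      (show x ^ 2 ∈ Set.Ici (0 : ℝ) from sq_nonneg x)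
      (show x ^ 2 + s * y ^ 2 ∈ Set.Ici (0 : ℝ) by simp only [Set.mem_Ici]; positivity)
      (show (0 : ℝ) ≤ 1 / 2 by norm_num) (show (0 : ℝ) ≤ 1 / 2 by norm_num) (by norm_num)
    simp only [smul_eq_mul] at this
    rw [← pow_mul] at this
    calc _ = (1 / 2 * x ^ 2 + 1 / 2 * (x ^ 2 + s * y ^ 2)) ^ (q + 1) := by congr 1; ring
      _ ≤ _ := this
      _ = _ := by ring
  linarith

/-- Comparison of `∑ j ^ (1 + ε)` over `j ≤ N` with `∫ x ^ (1 + ε)` over `[0, N + 1]`; the factor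
`1 / (2 + ε)` is weakened to `1 / 2`. -/
theorem sum_pow_le {ε : ℝ} (hε : 0 ≤ ε) (N : ℕ) :
    ∑ k ∈ Finset.range N, ((k : ℝ) + 1) ^ (1 + ε) ≤ (1 / 2) * ((N : ℝ) + 1) ^ (2 + ε) := by
  induction N with
  | zero => simp
  | succ N ih =>
    rw [Finset.sum_range_succ]
    have hj : (0 : ℝ) < (N : ℝ) + 1 := by positivity
    push_cast
    set j := (N : ℝ) + 1
    have e1 : (j + 1) ^ (2 + ε) = (j + 1) ^ 2 * (j + 1) ^ ε := by
      rw [Real.rpow_add (by positivity)]; norm_num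
    have e2 : j ^ (2 + ε) = j ^ 2 * j ^ ε := by
      rw [Real.rpow_add hj]; norm_num
    have e3 : j ^ (1 + ε) = j * j ^ ε := by
      rw [Real.rpow_add hj]; norm_num
    have h4 : j ^ ε ≤ (j + 1) ^ ε := Real.rpow_le_rpow hj.le (by linarith) hε
    rw [e1]; rw [e2] at ih; rw [e3]
    have h5 : 0 ≤ j ^ ε := by positivity
    nlinarith [mul_le_mul_of_nonneg_left h4 (sq_nonneg (j + 1))]

theorem integrable_pow_two_mul {Ω : Type*} {m0 : MeasurableSpace Ω} {μ : Measure Ω}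
    [IsProbabilityMeasure μ] {p : ℕ} (hp : 1 ≤ p) {X : Ω → ℝ} (hX : MemLp X (2 * (p : ℝ≥0∞)) μ) :
    Integrable (fun ω => X ω ^ (2 * p)) μ := by
  have h : MemLp X ((2 * p : ℕ) : ℝ≥0∞) μ := by push_cast; exact hX
  have := h.integrable_norm_pow (by omega)
  simpa [Real.norm_eq_abs, (even_two_mul p).pow_abs] using this

/-- Adding a conditionally centred `Y` to `X` increases the squared `L^{2p}` norm by at most
`(2p - 1)²` times the squared `L^{2p}` norm of `Y`. The squared norms are written as `p`-th roots of
`2p`-th moments. -/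
theorem moment_add_le {Ω : Type*} {m m0 : MeasurableSpace Ω} {μ : Measure Ω}
    [IsProbabilityMeasure μ] (hm : m ≤ m0) {p : ℕ} (hp : 1 ≤ p) {X Y : Ω → ℝ}
    (hX : MemLp X (2 * (p : ℝ≥0∞)) μ) (hY : MemLp Y (2 * (p : ℝ≥0∞)) μ)
    (hXm : StronglyMeasurable[m] X) (hYm : μ[Y | m] =ᵐ[μ] 0) :
    (∫⁻ ω, ENNReal.ofReal ((X ω + Y ω) ^ (2 * p)) ∂μ) ^ (1 / (p : ℝ)) ≤
      (∫⁻ ω, ENNReal.ofReal (X ω ^ (2 * p)) ∂μ) ^ (1 / (p : ℝ)) +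
      ENNReal.ofReal ((2 * p - 1) ^ 2) *
        (∫⁻ ω, ENNReal.ofReal (Y ω ^ (2 * p)) ∂μ) ^ (1 / (p : ℝ)) := by
  have hp0 : (0 : ℝ) < p := by exact_mod_cast hp
  have hp1 : (1 : ℝ) ≤ p := by exact_mod_cast hp
  set s : ℝ := (2 * p - 1) ^ 2 with hs
  have hs0 : 0 ≤ s := sq_nonneg _
  have iX := integrable_pow_two_mul hp hX
  have iY := integrable_pow_two_mul hp hY
  have iXY : Integrable (fun ω => (X ω + Y ω) ^ (2 * p)) μ :=
    integrable_pow_two_mul hp (hX.add hY)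
  have ev := even_two_mul p
  have iC : Integrable (fun ω => X ω ^ (2 * p - 1) * Y ω) μ := by
    refine (iX.add iY).mono ((hX.1.pow _).mul hY.1) (ae_of_all _ fun ω => ?_)
    have hx := ev.pow_nonneg (X ω)
    have hy := ev.pow_nonneg (Y ω)
    simp only [Pi.add_apply]
    rw [Real.norm_of_nonneg (add_nonneg hx hy), norm_mul, norm_pow, Real.norm_eq_abs,
      Real.norm_eq_abs]
    have e : 2 * p - 1 + 1 = 2 * p := by omega
    rcases le_total |X ω| |Y ω| with h | h
    · calc |X ω| ^ (2 * p - 1) * |Y ω| ≤ |Y ω| ^ (2 * p - 1) * |Y ω| := by gcongr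
        _ = Y ω ^ (2 * p) := by rw [← pow_succ, e, ev.pow_abs]
        _ ≤ _ := by linarith
    · calc |X ω| ^ (2 * p - 1) * |Y ω| ≤ |X ω| ^ (2 * p - 1) * |X ω| := by gcongr
        _ = X ω ^ (2 * p) := by rw [← pow_succ, e, ev.pow_abs]
        _ ≤ _ := by linarith
  have iYY : Integrable Y μ := hY.integrable (by
    have : (1 : ℝ≥0∞) ≤ p := by exact_mod_cast hp
    calc (1 : ℝ≥0∞) ≤ p := this
      _ ≤ 2 * p := le_mul_of_one_le_left zero_le (by norm_num))
  have hC0 : ∫ ω, X ω ^ (2 * p - 1) * Y ω ∂μ = 0 := by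
    rw [← integral_condExp hm]
    have h1 := condExp_mul_of_stronglyMeasurable_left (hXm.pow (2 * p - 1)) (μ := μ) (g := Y)
      iC iYY
    have h2 : μ[fun ω => X ω ^ (2 * p - 1) * Y ω | m] =ᵐ[μ] 0 := by
      refine h1.trans ?_
      filter_upwards [hYm] with ω h
      simp [h]
    rw [integral_congr_ae h2]; simp
  have iW : Integrable (fun ω => (X ω ^ 2 + s * Y ω ^ 2) ^ p) μ := by
    refine ((iX.add (iY.const_mul (s ^ p))).const_mul (2 ^ (p - 1))).mono
      (((hX.1.pow 2).add ((hY.1.pow 2).const_mul s)).pow p) (ae_of_all _ fun ω => ?_)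
    have hx := ev.pow_nonneg (X ω)
    have hy := ev.pow_nonneg (Y ω)
    have h := add_pow_le (sq_nonneg (X ω)) (mul_nonneg hs0 (sq_nonneg (Y ω))) p
    rw [mul_pow, ← pow_mul, ← pow_mul (Y ω)] at h
    rw [Real.norm_of_nonneg (by positivity)]
    exact h.trans (le_abs_self _)
  have hle : ∫ ω, (X ω + Y ω) ^ (2 * p) ∂μ ≤ ∫ ω, (X ω ^ 2 + s * Y ω ^ 2) ^ p ∂μ := by
    calc _ ≤ ∫ ω, (2 * p * (X ω ^ (2 * p - 1) * Y ω) + (X ω ^ 2 + s * Y ω ^ 2) ^ p) ∂μ := by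
          refine integral_mono iXY ((iC.const_mul _).add iW) fun ω => ?_
          have := add_pow_two_mul_le hp (X ω) (Y ω)
          simpa [mul_assoc] using this
      _ = _ := by
          rw [integral_add (iC.const_mul _) iW, integral_const_mul, hC0]; simp
  have hle' : ∫⁻ ω, ENNReal.ofReal ((X ω + Y ω) ^ (2 * p)) ∂μ ≤
      ∫⁻ ω, ENNReal.ofReal ((X ω ^ 2 + s * Y ω ^ 2) ^ p) ∂μ := by
    rw [← ofReal_integral_eq_lintegral_ofReal iXY (ae_of_all _ fun ω => ev.pow_nonneg _),
      ← ofReal_integral_eq_lintegral_ofReal iW (ae_of_all _ fun ω => by positivity)]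
    exact ENNReal.ofReal_le_ofReal hle
  calc _ ≤ (∫⁻ ω, ENNReal.ofReal ((X ω ^ 2 + s * Y ω ^ 2) ^ p) ∂μ) ^ (1 / (p : ℝ)) := by gcongr
    _ = (∫⁻ ω, ((fun ω => ENNReal.ofReal (X ω ^ 2)) + fun ω => ENNReal.ofReal (s * Y ω ^ 2)) ω
          ^ (p : ℝ) ∂μ) ^ (1 / (p : ℝ)) := by
        congr 2 with ω
        rw [ENNReal.ofReal_pow (by positivity), ENNReal.ofReal_add (by positivity) (by positivity),
          ENNReal.rpow_natCast]; rfl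
    _ ≤ (∫⁻ ω, ENNReal.ofReal (X ω ^ 2) ^ (p : ℝ) ∂μ) ^ (1 / (p : ℝ)) +
        (∫⁻ ω, ENNReal.ofReal (s * Y ω ^ 2) ^ (p : ℝ) ∂μ) ^ (1 / (p : ℝ)) :=
        ENNReal.lintegral_Lp_add_le (hX.1.aemeasurable.pow_const 2).ennreal_ofReal
          ((hY.1.aemeasurable.pow_const 2).const_mul s).ennreal_ofReal hp1
    _ = _ := by
        congr 1
        · congr 2 with ω
          rw [ENNReal.rpow_natCast, ← ENNReal.ofReal_pow (sq_nonneg _), ← pow_mul]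
        · have : ∀ ω, ENNReal.ofReal (s * Y ω ^ 2) ^ (p : ℝ) =
              ENNReal.ofReal s ^ (p : ℝ) * ENNReal.ofReal (Y ω ^ (2 * p)) := fun ω => by
            rw [ENNReal.ofReal_mul hs0, ENNReal.mul_rpow_of_nonneg _ _ hp0.le, pow_mul,
              ENNReal.ofReal_pow (sq_nonneg _), ENNReal.rpow_natCast, ENNReal.rpow_natCast]
          simp_rw [this]
          rw [lintegral_const_mul' _ _ (by simp), ENNReal.mul_rpow_of_nonneg _ _ (by positivity),
            ← ENNReal.rpow_mul, mul_one_div_cancel hp0.ne', ENNReal.rpow_one]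

/-- Moment bound for a martingale started at `0`, by iterating `moment_add_le`: `β k` bounds the
squared `L^{2p}` norm of the `k`-th increment. -/
theorem martingale_moment_le {Ω : Type*} {m0 : MeasurableSpace Ω} {μ : Measure Ω}
    [IsProbabilityMeasure μ] {p : ℕ} (hp : 1 ≤ p) {G : ℕ → MeasurableSpace Ω}
    (hG : ∀ n, G n ≤ m0) {M : ℕ → Ω → ℝ} (h0 : M 0 =ᵐ[μ] 0)
    (hM : ∀ n, MemLp (M n) (2 * (p : ℝ≥0∞)) μ) (hMm : ∀ n, StronglyMeasurable[G n] (M n))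
    (hinc : ∀ n, μ[M (n + 1) - M n | G n] =ᵐ[μ] 0) {β : ℕ → ℝ≥0∞}
    (hβ : ∀ n, (∫⁻ ω, ENNReal.ofReal ((M (n + 1) ω - M n ω) ^ (2 * p)) ∂μ) ^ (1 / (p : ℝ)) ≤ β n)
    (n : ℕ) :
    (∫⁻ ω, ENNReal.ofReal (M n ω ^ (2 * p)) ∂μ) ^ (1 / (p : ℝ)) ≤
      ENNReal.ofReal ((2 * p - 1) ^ 2) * ∑ k ∈ Finset.range n, β k := by
  have hp0 : (0 : ℝ) < p := by exact_mod_cast hp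
  induction n with
  | zero =>
    have : ∫⁻ ω, ENNReal.ofReal (M 0 ω ^ (2 * p)) ∂μ = 0 := by
      rw [lintegral_congr_ae (g := 0), Pi.zero_def, lintegral_zero]
      filter_upwards [h0] with ω h
      simp [h, zero_pow (by omega : 2 * p ≠ 0)]
    rw [this, ENNReal.zero_rpow_of_pos (by positivity)]; exact zero_le
  | succ n ih =>
    have h := moment_add_le (hG n) hp (hM n) ((hM (n + 1)).sub (hM n)) (hMm n) (hinc n)
    simp only [Pi.sub_apply, add_sub_cancel] at h
    rw [Finset.sum_range_succ, mul_add]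
    exact h.trans (add_le_add ih (by gcongr; exact hβ n))

/-! ### The Markov property of the two-sided chain -/

section MarkovProperty

variable {E : Type*}

/-- The two-sided sequence that follows `x` strictly before time `i`, and `u` from time `i` on. -/
def glue (i : ℤ) (x : ℤ → E) (u : ℕ → E) : ℤ → E := fun j => if j < i then x j else u (j - i).toNat

theorem glue_of_lt {i j : ℤ} (h : j < i) (x : ℤ → E) (u : ℕ → E) : glue i x u j = x j := if_pos h

theorem glue_add (i : ℤ) (x : ℤ → E) (u : ℕ → E) (k : ℕ) : glue i x u (i + k) = u k := by
  simp [glue]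

theorem measurable_glue [MeasurableSpace E] (i : ℤ) :
    Measurable (fun q : (ℤ → E) × (ℕ → E) => glue i q.1 q.2) := by
  refine measurable_pi_iff.2 fun j => ?_
  by_cases h : j < i
  · simp only [glue, h, if_true]; fun_prop
  · simp only [glue, h, if_false]; fun_prop

/-- Stationarity, for shifts by an arbitrary integer. -/
theorem IsStationaryMarkov.map_shift [MeasurableSpace E] {κ : Kernel E E} {ν : Measure E} {P : Measure (ℤ → E)}
    (hP : IsStationaryMarkov κ ν P) (a : ℤ) :
    P.map (fun (x : ℤ → E) (n : ℤ) => x (n + a)) = P := by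
  have hm : ∀ a : ℤ, Measurable (fun (x : ℤ → E) (n : ℤ) => x (n + a)) := fun a => by fun_prop
  induction a using Int.induction_on with
  | zero => simp
  | succ n ih =>
    conv_rhs => rw [← hP.stationary, ← ih, Measure.map_map (hm 1) (hm _)]
    congr 1 with x k
    simp only [Function.comp]; congr 1; ring
  | pred n ih =>
    calc P.map (fun (x : ℤ → E) (k : ℤ) => x (k + (-n - 1)))
        = (P.map (fun (x : ℤ → E) (k : ℤ) => x (k + 1))).map
            (fun (x : ℤ → E) (k : ℤ) => x (k + (-n - 1))) := by rw [hP.stationary]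
      _ = P.map (fun (x : ℤ → E) (k : ℤ) => x (k + -n)) := by
          rw [Measure.map_map (hm _) (hm _)]
          congr 1 with x k
          simp only [Function.comp]; congr 1; ring
      _ = P := ih

section Past

variable [MeasurableSpace E]

theorem pastSigma_le (i : ℤ) : pastSigma E i ≤ MeasurableSpace.pi :=
  iSup₂_le fun k _ => (measurable_pi_apply k).comap_le

theorem pastSigma_mono {i j : ℤ} (h : i ≤ j) : pastSigma E i ≤ pastSigma E j :=
  iSup₂_le fun k hk => le_iSup₂_of_le k (hk.trans h) le_rfl

theorem measurable_coord_past {i k : ℤ} (h : k ≤ i) :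
    Measurable[pastSigma E i] (fun x : ℤ → E => x k) :=
  Measurable.mono (comap_measurable _) (le_iSup₂_of_le k h le_rfl) le_rfl

theorem measurable_restrict_past (i : ℤ) :
    Measurable[pastSigma E i] (fun (x : ℤ → E) (k : Set.Iic i) => x k) :=
  @measurable_pi_lambda _ _ _ (pastSigma E i) _ _ fun k => measurable_coord_past k.2

/-- Events of the past up to `i` depend on the coordinates up to `i` only. -/
theorem mem_iff_of_pastSigma {i : ℤ} {A : Set (ℤ → E)} (hA : MeasurableSet[pastSigma E i] A)
    {x y : ℤ → E} (hxy : ∀ k ≤ i, x k = y k) : x ∈ A ↔ y ∈ A := by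
  have hle : pastSigma E i ≤
      MeasurableSpace.comap (fun (x : ℤ → E) (k : Set.Iic i) => x k) inferInstance :=
    iSup₂_le fun k hk => by
      rintro _ ⟨B, hB, rfl⟩
      exact ⟨(fun z => z ⟨k, hk⟩) ⁻¹' B, measurable_pi_apply _ hB, rfl⟩
  obtain ⟨B, -, rfl⟩ := hle A hA
  have : (fun k : Set.Iic i => x k) = fun k : Set.Iic i => y k := funext fun k => hxy k k.2
  simp only [Set.mem_preimage, this]

/-- If redrawing the trajectory from time `i` on with a kernel applied to the state at time `j`
preserves `P` and leaves the past up to `j` unchanged, then averaging over the redrawn trajectories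
is the conditional expectation given the past up to `j`. -/
theorem condExp_glue {P : Measure (ℤ → E)} [IsProbabilityMeasure P] {η : Kernel E (ℕ → E)}
    [IsMarkovKernel η] {i j : ℤ} (hij : i ≤ j + 1)
    (hmap : (P ⊗ₘ (η.comap (fun x : ℤ → E => x j) (by fun_prop))).map
      (fun q => glue i q.1 q.2) = P)
    (hagree : ∀ᵐ q ∂(P ⊗ₘ (η.comap (fun x : ℤ → E => x j) (by fun_prop))),
      ∀ k ≤ j, glue i q.1 q.2 k = q.1 k)
    {f : (ℤ → E) → ℝ} (hfm : Measurable f) (hf : Integrable f P) :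
    (∀ᵐ x ∂P, Integrable (fun u => f (glue i x u)) (η (x j))) ∧
      P[f | pastSigma E j] =ᵐ[P] fun x => ∫ u, f (glue i x u) ∂(η (x j)) := by
  have hg := measurable_glue (E := E) i
  have hint : Integrable (fun q : (ℤ → E) × (ℕ → E) => f (glue i q.1 q.2))
      (P ⊗ₘ (η.comap (fun x : ℤ → E => x j) (by fun_prop))) := by
    rw [← hmap] at hf
    exact (integrable_map_measure hfm.aestronglyMeasurable hg.aemeasurable).1 hf
  have hint' := (Measure.integrable_compProd_iff hint.1).1 hint
  have hgi : Integrable (fun x => ∫ u, f (glue i x u) ∂(η (x j))) P := by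
    refine hint'.2.mono ?_ (ae_of_all _ fun x => ?_)
    · exact ((hfm.comp hg).stronglyMeasurable.integral_kernel_prod_right'
        (κ := η.comap (fun x : ℤ → E => x j) (by fun_prop))).aestronglyMeasurable
    · rw [Real.norm_of_nonneg (integral_nonneg fun _ => norm_nonneg _)]
      exact norm_integral_le_integral_norm _
  refine ⟨hint'.1, (ae_eq_condExp_of_forall_setIntegral_eq (pastSigma_le j) hf
    (fun s _ _ => hgi.integrableOn) (fun s hs _ => ?_) ?_).symm⟩
  · have hs' := pastSigma_le j s hs
    have hint2 := hint.indicator (hs'.preimage hg)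
    rw [← integral_indicator hs', ← integral_indicator hs']
    conv_rhs => rw [← hmap]
    rw [integral_map hg.aemeasurable (hfm.indicator hs').aestronglyMeasurable]
    have e : ∀ᵐ q ∂(P ⊗ₘ (η.comap (fun x : ℤ → E => x j) (by fun_prop))),
        s.indicator f (glue i q.1 q.2) =
          (s ×ˢ Set.univ).indicator (fun q => f (glue i q.1 q.2)) q := by
      filter_upwards [hagree] with q hq
      have := mem_iff_of_pastSigma hs hq
      by_cases h : q.1 ∈ s
      · rw [Set.indicator_of_mem (this.2 h), Set.indicator_of_mem (by simpa using h)]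
      · rw [Set.indicator_of_notMem (mt this.1 h), Set.indicator_of_notMem (by simpa using h)]
    rw [integral_congr_ae e, Measure.integral_compProd
      (hint.indicator (hs'.prod MeasurableSet.univ))]
    congr 1 with x
    by_cases h : x ∈ s
    · rw [Set.indicator_of_mem h]; simp [Set.indicator, h]
    · rw [Set.indicator_of_notMem h]; simp [Set.indicator, h]
  · have hext : Measurable (fun (y : Set.Iic j → E) (k : ℤ) =>
        if h : k ≤ j then y ⟨k, h⟩ else y ⟨j, Set.self_mem_Iic⟩) := by
      refine measurable_pi_iff.2 fun k => ?_
      by_cases h : k ≤ j <;> simp only [h, dite_true, dite_false] <;> fun_prop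
    have hsm : StronglyMeasurable (fun y : Set.Iic j → E => ∫ u, f (glue i
        (fun k : ℤ => if h : k ≤ j then y ⟨k, h⟩ else y ⟨j, Set.self_mem_Iic⟩) u) ∂(η (y ⟨j, Set.self_mem_Iic⟩))) :=
      ((hfm.comp hg).comp ((hext.comp measurable_fst).prodMk
        measurable_snd)).stronglyMeasurable.integral_kernel_prod_right'
        (κ := η.comap (fun y : Set.Iic j → E => y ⟨j, Set.self_mem_Iic⟩) (by fun_prop))
    have := hsm.comp_measurable (measurable_restrict_past j)
    refine StronglyMeasurable.aestronglyMeasurable ?_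
    convert this using 2 with x
    simp only [Function.comp]
    congr 1 with u
    congr 1
    ext k
    by_cases h : k < i
    · rw [glue_of_lt h, glue_of_lt h, dif_pos (by omega)]
    · simp [glue, h]

end Past

variable [Countable E] [MeasurableSpace E] [DiscreteMeasurableSpace E]

/-- Finite measures on `ι → E`, with `E` countable, agree if they agree on the cylinders over
arbitrarily large finite sets of coordinates. -/
theorem measure_ext_of_cylinders {ι : Type*} {μ μ' : Measure (ι → E)} [IsFiniteMeasure μ]
    [IsFiniteMeasure μ']
    (h : ∀ I : Finset ι, ∃ J : Finset ι, I ⊆ J ∧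
      ∀ w : ι → E, μ {x | ∀ k ∈ J, x k = w k} = μ' {x | ∀ k ∈ J, x k = w k}) : μ = μ' := by
  classical
  have key : ∀ I : Finset ι, μ.map I.restrict = μ'.map I.restrict := fun I => by
    obtain ⟨J, hIJ, hJ⟩ := h I
    have hJ' : μ.map J.restrict = μ'.map J.restrict := by
      refine Measure.ext_of_singleton fun v => ?_
      have hm : Measurable (J.restrict : (ι → E) → ((i : J) → E)) := Finset.measurable_restrict J
      rw [Measure.map_apply hm (measurableSet_singleton _),
        Measure.map_apply hm (measurableSet_singleton _)]
      by_cases hw : ∃ w : ι → E, J.restrict w = v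
      · obtain ⟨w, rfl⟩ := hw
        have e : (J.restrict ⁻¹' {J.restrict w} : Set (ι → E)) = {x | ∀ k ∈ J, x k = w k} := by
          ext x
          simp [funext_iff]
        rw [e, hJ w]
      · have e : (J.restrict ⁻¹' {v} : Set (ι → E)) = ∅ := by
          ext x
          simp only [Set.mem_preimage, Set.mem_singleton_iff, Set.mem_empty_iff_false, iff_false]
          exact fun hx => hw ⟨x, hx⟩
        rw [e, measure_empty, measure_empty]
    have e : (I.restrict : (ι → E) → _) = Finset.restrict₂ (π := fun _ => E) hIJ ∘ J.restrict := by
      rfl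
    rw [e, ← Measure.map_map (Finset.measurable_restrict₂ hIJ) (Finset.measurable_restrict J),
      ← Measure.map_map (Finset.measurable_restrict₂ hIJ) (Finset.measurable_restrict J), hJ']
  have h1 : IsProjectiveLimit μ (fun I => μ.map I.restrict) := fun _ => rfl
  have h2 : IsProjectiveLimit μ' (fun I => μ.map I.restrict) := fun I => (key I).symm
  have : ∀ I : Finset ι, IsFiniteMeasure (μ.map I.restrict) := fun I => inferInstance
  exact h1.unique h2

/-- The law of a Markov chain is determined by its kernel and its initial distribution. -/
theorem IsMarkovLaw.ext {κ : Kernel E E} {μ : Measure E} {Q Q' : Measure (ℕ → E)}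
    [IsFiniteMeasure Q] [IsFiniteMeasure Q'] (h : IsMarkovLaw κ μ Q) (h' : IsMarkovLaw κ μ Q') :
    Q = Q' := by
  refine measure_ext_of_cylinders fun I => ⟨Finset.range (I.sup id + 1), fun k hk => ?_, fun w => ?_⟩
  · exact Finset.mem_range_succ_iff.2 (Finset.le_sup (f := id) hk)
  · have := (h (I.sup id) w).trans (h' (I.sup id) w).symm
    simpa only [Finset.mem_range, Nat.lt_succ_iff] using this

theorem IsMarkovLaw.univ {κ : Kernel E E} {μ : Measure E} {Q : Measure (ℕ → E)}
    (h : IsMarkovLaw κ μ Q) : Q Set.univ = μ Set.univ := by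
  rcases isEmpty_or_nonempty E with hE | ⟨⟨e⟩⟩
  · rw [Set.eq_empty_of_isEmpty (Set.univ : Set (ℕ → E)), Set.eq_empty_of_isEmpty (Set.univ : Set E)]
    simp
  have e1 : (Set.univ : Set (ℕ → E)) = ⋃ a : E, {u | u 0 = a} := by ext u; simp
  have e2 : (Set.univ : Set E) = ⋃ a : E, {a} := by ext u; simp
  rw [e1, e2, measure_iUnion, measure_iUnion]
  · congr 1 with a
    simpa using h 0 (fun _ => a)
  · intro a b hab; simpa using hab
  · exact fun a => measurableSet_singleton a
  · intro a b hab
    exact Set.disjoint_left.2 fun u (h1 : u 0 = a) (h2 : u 0 = b) => hab (h1.symm.trans h2)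
  · exact fun a => measurableSet_preimage (t := {a})
      (measurable_pi_apply (X := fun _ : ℕ => E) 0) (measurableSet_singleton a)

theorem IsMarkovLaw.isProbabilityMeasure {κ : Kernel E E} {μ : Measure E} [IsProbabilityMeasure μ]
    {Q : Measure (ℕ → E)} (h : IsMarkovLaw κ μ Q) : IsProbabilityMeasure Q :=
  ⟨by rw [h.univ, measure_univ]⟩

theorem IsChainCoupling.isProbabilityMeasure {κ : Kernel E E}
    {Phat : E → E → Measure ((ℕ → E) × (ℕ → E))} (h : IsChainCoupling κ Phat) (x y : E) :
    IsProbabilityMeasure (Phat x y) := by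
  have := (h.left x y).isProbabilityMeasure
  exact Measure.isProbabilityMeasure_of_map Prod.fst

theorem measurableSet_cylinder_le {ι : Type*} (g : ℕ → ι) (w : ℕ → E) (n : ℕ) :
    MeasurableSet {x : ι → E | ∀ k ≤ n, x (g k) = w k} := by
  simp only [Set.ofPred_forall]
  exact MeasurableSet.iInter fun k => .iInter fun _ =>
    measurableSet_preimage (t := {w k}) (measurable_pi_apply (X := fun _ : ι => E) (g k))
      (measurableSet_singleton (w k))

theorem IsStationaryMarkov.cylinder {κ : Kernel E E} {ν : Measure E} {P : Measure (ℤ → E)}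
    (hP : IsStationaryMarkov κ ν P) (a : ℤ) (n : ℕ) (w : ℕ → E) :
    P {x | ∀ k ≤ n, x (a + k) = w k} = ν {w 0} * ∏ k ∈ Finset.range n, κ (w k) {w (k + 1)} := by
  have hS : MeasurableSet {u : ℕ → E | ∀ k ≤ n, u k = w k} := measurableSet_cylinder_le id w n
  rw [← hP.markov n w, Measure.map_apply (by fun_prop) hS]
  conv_rhs => rw [← hP.map_shift a]
  rw [Measure.map_apply (by fun_prop) (hS.preimage (by fun_prop))]
  simp only [Set.preimage_ofPred_eq, add_comm]

theorem exists_window (i : ℤ) (I : Finset ℤ) :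
    ∃ n : ℕ, ∀ k ∈ I, i - n ≤ k ∧ k ≤ i + n := by
  refine ⟨(I.sup Int.natAbs) + i.natAbs, fun k hk => ?_⟩
  have := Finset.le_sup (f := Int.natAbs) hk
  omega

/-- Finite measures on `ℤ → E` agree if they agree on the cylinders over all windows
`j - n, …, j + 1 + n`. -/
theorem measure_ext_of_windows {P P' : Measure (ℤ → E)} [IsFiniteMeasure P] [IsFiniteMeasure P']
    (j : ℤ) (h : ∀ (n : ℕ) (w : ℕ → E), P {x | ∀ k ≤ n + (n + 1), x (j - n + k) = w k} =
      P' {x | ∀ k ≤ n + (n + 1), x (j - n + k) = w k}) : P = P' := by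
  refine measure_ext_of_cylinders fun I => ?_
  obtain ⟨n, hn⟩ := exists_window j I
  refine ⟨Finset.Icc (j - n) (j + 1 + n), fun k hk => Finset.mem_Icc.2 ?_, fun w => ?_⟩
  · have := hn k hk; omega
  have e : {x : ℤ → E | ∀ k ∈ Finset.Icc (j - n) (j + 1 + n), x k = w k} =
      {x | ∀ k ≤ n + (n + 1), x (j - n + k) = w (j - n + k)} := by
    ext x
    simp only [Finset.mem_Icc, Set.mem_ofPred_eq]
    constructor
    · exact fun hx k hk => hx _ (by omega)
    · intro hx k hk
      have := hx (k - (j - n)).toNat (by omega)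
      rwa [show j - n + ((k - (j - n)).toNat : ℤ) = k by omega] at this
  rw [e]
  exact h n fun k => w (j - n + k)

/-- Redrawing the trajectory from time `i` on, according to a kernel `η` applied to the state at
time `j`, preserves the law of the chain as soon as `η` gives the cylinders around the last
retained time `j` their Markovian conditional probabilities. -/
theorem IsStationaryMarkov.map_glue_of_cylinder {κ : Kernel E E} {ν : Measure E}
    {P : Measure (ℤ → E)} [IsProbabilityMeasure P] (hP : IsStationaryMarkov κ ν P)
    {η : Kernel E (ℕ → E)} [IsMarkovKernel η] (i j : ℤ)
    (h : ∀ (n : ℕ) (w : ℕ → E) (x : ℤ → E),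
      η (x j) {u | ∀ k ≤ n + (n + 1), glue i x u (j - n + k) = w k} =
        {x : ℤ → E | ∀ k ≤ n, x (j - n + k) = w k}.indicator
          (fun _ => ∏ k ∈ Finset.range (n + 1), κ (w (n + k)) {w (n + k + 1)}) x) :
    (P ⊗ₘ (η.comap (fun x : ℤ → E => x j) (by fun_prop))).map (fun q => glue i q.1 q.2) = P := by
  have : IsProbabilityMeasure ((P ⊗ₘ (η.comap (fun x : ℤ → E => x j) (by fun_prop))).map
      (fun q => glue i q.1 q.2)) := Measure.isProbabilityMeasure_map (measurable_glue i).aemeasurable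
  refine measure_ext_of_windows j fun n w => ?_
  have hS := measurableSet_cylinder_le (fun k : ℕ => j - n + k) w (n + (n + 1))
  have hS' := measurableSet_cylinder_le (fun k : ℕ => j - n + k) w n
  rw [Measure.map_apply (measurable_glue i) hS, Measure.compProd_apply (measurable_glue i hS)]
  refine (lintegral_congr (h n w)).trans ?_
  rw [lintegral_indicator hS', setLIntegral_const, hP.cylinder, hP.cylinder,
    Finset.prod_range_add _ n (n + 1)]
  ring

/-- Markov property at time `i`: restarting the chain at time `i` from its state at that
time does not change the law. -/
theorem IsStationaryMarkov.map_glue {κ : Kernel E E} {ν : Measure E} {P : Measure (ℤ → E)}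
    [IsProbabilityMeasure P] (hP : IsStationaryMarkov κ ν P) {Q : Kernel E (ℕ → E)}
    [IsMarkovKernel Q] (hQ : ∀ z, IsMarkovLaw κ (Measure.dirac z) (Q z)) (i : ℤ) :
    (P ⊗ₘ (Q.comap (fun x : ℤ → E => x i) (by fun_prop))).map (fun q => glue i q.1 q.2) = P := by
  refine hP.map_glue_of_cylinder i i fun n w x => ?_
  have e : {u | ∀ k ≤ n + (n + 1), glue i x u (i - n + k) = w k} =
      {u | (∀ k < n, x (i - n + k) = w k) ∧ ∀ k ≤ n + 1, u k = w (n + k)} := by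
    ext u
    simp only [Set.mem_ofPred_eq]
    constructor
    · refine fun hx => ⟨fun k hk => ?_, fun k hk => ?_⟩
      · rw [← hx k (by omega), glue_of_lt (by omega)]
      · rw [← hx (n + k) (by omega), ← glue_add i x u k]; congr 1; push_cast; ring
    · rintro ⟨h1, h2⟩ k hk
      rcases lt_or_ge k n with h | h
      · rw [glue_of_lt (by omega), h1 k h]
      · obtain ⟨l, rfl⟩ := Nat.exists_eq_add_of_le h
        rw [← h2 l (by omega), ← glue_add i x u l]; congr 1; push_cast; ring
  rw [e]
  have hcyl := hQ (x i) (n + 1) (fun k => w (n + k))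
  simp only [add_zero, ← add_assoc] at hcyl
  by_cases h1 : ∀ k < n, x (i - n + k) = w k
  · have e2 : {u : ℕ → E | (∀ k < n, x (i - n + k) = w k) ∧ ∀ k ≤ n + 1, u k = w (n + k)} =
        {u | ∀ k ≤ n + 1, u k = w (n + k)} := by ext u; simp only [Set.mem_ofPred_eq]; tauto
    rw [e2, hcyl]
    by_cases h2 : x i = w n
    · rw [Set.indicator_of_mem]
      · simp [h2]
      · intro k hk
        rcases hk.lt_or_eq with h | rfl
        · exact h1 k h
        · simpa using h2
    · rw [Set.indicator_of_notMem]
      · simp [h2]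
      · intro h; exact h2 (by simpa using h n le_rfl)
  · rw [Set.indicator_of_notMem fun h : ∀ k ≤ n, _ => h1 fun k hk => h k hk.le]
    simp [h1]

/-- Markov property at time `i - 1`: letting the chain jump according to `κ` from its
state at time `i - 1` and then restarting it does not change the law. -/
theorem IsStationaryMarkov.map_glue_comp {κ : Kernel E E} [IsMarkovKernel κ] {ν : Measure E}
    {P : Measure (ℤ → E)} [IsProbabilityMeasure P] (hP : IsStationaryMarkov κ ν P)
    {Q : Kernel E (ℕ → E)} [IsMarkovKernel Q]
    (hQ : ∀ z, IsMarkovLaw κ (Measure.dirac z) (Q z)) (i : ℤ) :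
    (P ⊗ₘ ((Q ∘ₖ κ).comap (fun x : ℤ → E => x (i - 1)) (by fun_prop))).map
      (fun q => glue i q.1 q.2) = P := by
  refine hP.map_glue_of_cylinder i (i - 1) fun n w x => ?_
  have e : {u | ∀ k ≤ n + (n + 1), glue i x u (i - 1 - n + k) = w k} =
      {u | (∀ k ≤ n, x (i - 1 - n + k) = w k) ∧ ∀ k ≤ n, u k = w (n + 1 + k)} := by
    ext u
    simp only [Set.mem_ofPred_eq]
    constructor
    · refine fun hx => ⟨fun k hk => ?_, fun k hk => ?_⟩
      · rw [← hx k (by omega), glue_of_lt (by omega)]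
      · rw [← hx (n + 1 + k) (by omega), ← glue_add i x u k]; congr 1; push_cast; ring
    · rintro ⟨h1, h2⟩ k hk
      rcases le_or_gt k n with h | h
      · rw [glue_of_lt (by omega), h1 k h]
      · obtain ⟨l, rfl⟩ := Nat.exists_eq_add_of_le (Nat.succ_le_of_lt h)
        rw [← h2 l (by omega), ← glue_add i x u l]; congr 1; push_cast; ring
  rw [e]
  by_cases h1 : ∀ k ≤ n, x (i - 1 - n + k) = w k
  · have e2 : {u : ℕ → E | (∀ k ≤ n, x (i - 1 - n + k) = w k) ∧ ∀ k ≤ n, u k = w (n + 1 + k)} =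
        {u | ∀ k ≤ n, u k = w (n + 1 + k)} := by ext u; simp only [Set.mem_ofPred_eq]; tauto
    have hx : x (i - 1) = w n := by simpa using h1 n le_rfl
    have hS : MeasurableSet {u : ℕ → E | ∀ k ≤ n, u k = w (n + 1 + k)} :=
      measurableSet_cylinder_le id (fun k => w (n + 1 + k)) n
    rw [e2, Set.indicator_of_mem (by exact h1), hx, Kernel.comp_apply' _ _ _ hS]
    have hcyl : ∀ z, Q z {u | ∀ k ≤ n, u k = w (n + 1 + k)} =
        ({w (n + 1)} : Set E).indicator
          (fun _ => ∏ k ∈ Finset.range n, κ (w (n + (k + 1))) {w (n + (k + 1) + 1)}) z := fun z => by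
      rw [hQ z n (fun k => w (n + 1 + k))]
      by_cases hz : z = w (n + 1)
      · simp [hz, add_comm, add_left_comm]
      · simp [hz]
    rw [lintegral_congr hcyl, lintegral_indicator (measurableSet_singleton _), setLIntegral_const,
      Finset.prod_range_succ']
    rfl
  · rw [Set.indicator_of_notMem (by exact h1)]
    simp [h1]

/-- The conditional expectation given the past up to `i` averages over the chain restarted at time
`i` from its state at that time. -/
theorem IsStationaryMarkov.condExp_self {κ : Kernel E E} {ν : Measure E} {P : Measure (ℤ → E)}
    [IsProbabilityMeasure P] (hP : IsStationaryMarkov κ ν P) {Q : Kernel E (ℕ → E)}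
    [IsMarkovKernel Q] (hQ : ∀ z, IsMarkovLaw κ (Measure.dirac z) (Q z)) (i : ℤ)
    {f : (ℤ → E) → ℝ} (hfm : Measurable f) (hf : Integrable f P) :
    (∀ᵐ x ∂P, Integrable (fun u => f (glue i x u)) (Q (x i))) ∧
      P[f | pastSigma E i] =ᵐ[P] fun x => ∫ u, f (glue i x u) ∂(Q (x i)) := by
  refine condExp_glue (by omega) (hP.map_glue hQ i) ?_ hfm hf
  have h0 : ∀ z, ∀ᵐ u ∂(Q z), u 0 = z := fun z => by
    rw [ae_iff_prob_eq_one (by measurability)]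
    simpa using hQ z 0 (fun _ => z)
  have h1 : ∀ᵐ q ∂(P ⊗ₘ (Q.comap (fun x : ℤ → E => x i) (by fun_prop))), q.2 0 = q.1 i :=
    Measure.ae_compProd_of_ae_ae (by measurability) (ae_of_all _ fun x => h0 (x i))
  filter_upwards [h1] with q hq k hk
  rcases hk.lt_or_eq with h | rfl
  · exact glue_of_lt h _ _
  · rw [← hq]; simpa using glue_add k q.1 q.2 0

/-- The conditional expectation given the past before `i` averages over the chain restarted at
time `i` after a fresh jump from its state at time `i - 1`. -/
theorem IsStationaryMarkov.condExp_pred {κ : Kernel E E} [IsMarkovKernel κ] {ν : Measure E}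
    {P : Measure (ℤ → E)} [IsProbabilityMeasure P] (hP : IsStationaryMarkov κ ν P)
    {Q : Kernel E (ℕ → E)} [IsMarkovKernel Q]
    (hQ : ∀ z, IsMarkovLaw κ (Measure.dirac z) (Q z)) (i : ℤ)
    {f : (ℤ → E) → ℝ} (hfm : Measurable f) (hf : Integrable f P) :
    (∀ᵐ x ∂P, Integrable (fun u => f (glue i x u)) ((Q ∘ₖ κ) (x (i - 1)))) ∧
      P[f | pastSigma E (i - 1)] =ᵐ[P] fun x => ∫ u, f (glue i x u) ∂((Q ∘ₖ κ) (x (i - 1))) :=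
  condExp_glue (by omega) (hP.map_glue_comp hQ i)
    (ae_of_all _ fun q k hk => glue_of_lt (by omega) q.1 q.2) hfm hf

end MarkovProperty

/-! ### Convergence of conditional expectations along the past -/

section ReverseMartingale

variable {Ω : Type*} {m0 : MeasurableSpace Ω} {μ : Measure Ω}

/-- Conditional expectations along a decreasing sequence of sigma-fields converge in `L²`, being
orthogonal projections onto a decreasing sequence of closed subspaces. -/
theorem exists_tendsto_condExp_of_antitone [IsFiniteMeasure μ] {m : ℕ → MeasurableSpace Ω}
    (hm : ∀ n, m n ≤ m0) (hanti : Antitone m) {f : Ω → ℝ} (hf : MemLp f 2 μ) :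
    ∃ g : Ω → ℝ, MemLp g 2 μ ∧ Tendsto (fun n => eLpNorm (μ[f | m n] - g) 2 μ) atTop (𝓝 0) := by
  have hfact : ∀ n, Fact (m n ≤ m0) := fun n => ⟨hm n⟩
  let U : ℕ → Submodule ℝ (Lp ℝ 2 μ) := fun n => lpMeas ℝ ℝ (m n) 2 μ
  have hU : ∀ n, (U n).HasOrthogonalProjection := fun n => by
    have : CompleteSpace (lpMeas ℝ ℝ (m n) 2 μ) := inferInstance
    exact inferInstanceAs ((lpMeas ℝ ℝ (m n) 2 μ).HasOrthogonalProjection)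
  have hmono : Monotone fun n => (U n)ᗮ := fun a b hab =>
    Submodule.orthogonal_le fun x hx => mem_lpMeas_iff_aestronglyMeasurable.2
      ((mem_lpMeas_iff_aestronglyMeasurable.1 hx).mono (hanti hab))
  have hlim := Submodule.starProjection_tendsto_closure_iSup (fun n => (U n)ᗮ) hmono hf.toLp
  set y := (⨆ n, (U n)ᗮ).topologicalClosure.starProjection hf.toLp
  refine ⟨(hf.toLp - y : Lp ℝ 2 μ), Lp.memLp _, ?_⟩
  have hlim2 : Tendsto (fun n => (U n).starProjection hf.toLp) atTop (𝓝 (hf.toLp - y)) := by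
    have := (tendsto_const_nhds (x := hf.toLp)).sub hlim
    refine this.congr fun n => ?_
    rw [Submodule.starProjection_orthogonal_val]; abel
  refine ((Lp.tendsto_Lp_iff_tendsto_eLpNorm' _ _).1 hlim2).congr fun n => eLpNorm_congr_ae ?_
  exact (hf.condExpL2_ae_eq_condExp (𝕜 := ℝ) (hm n)).sub EventuallyEq.rfl

/-- **Reverse martingale convergence** in `L²`, for a trivial limiting sigma-field. -/
theorem tendsto_condExp_of_antitone_of_trivial [IsProbabilityMeasure μ]
    {m : ℕ → MeasurableSpace Ω} (hm : ∀ n, m n ≤ m0) (hanti : Antitone m)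
    (htriv : ∀ A, MeasurableSet[⨅ n, m n] A → μ A = 0 ∨ μ A = 1) {f : Ω → ℝ} (hf : MemLp f 2 μ) :
    Tendsto (fun n => eLpNorm (μ[f | m n] - fun _ => ∫ ω, f ω ∂μ) 2 μ) atTop (𝓝 0) := by
  obtain ⟨g, hg, hlim⟩ := exists_tendsto_condExp_of_antitone hm hanti hf
  have hsm : ∀ n, AEStronglyMeasurable (μ[f | m n]) μ := fun n =>
    (stronglyMeasurable_condExp.mono (hm n)).aestronglyMeasurable
  obtain ⟨ns, hns, hae⟩ := (tendstoInMeasure_of_tendsto_eLpNorm two_ne_zero hsm hg.1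
    hlim).exists_seq_tendsto_ae
  -- The upper limit of a subsequence is a version of the limit measurable with respect to
  -- every sigma-field of the sequence.
  let h : Ω → ℝ := fun ω => limsup (fun k => (μ[f | m (ns k)]) ω) atTop
  have hh : g =ᵐ[μ] h := by
    filter_upwards [hae] with ω hω using hω.limsup_eq.symm
  have hmeas : Measurable[⨅ n, m n] h := by
    intro s hs
    rw [MeasurableSpace.measurableSet_iInf]
    intro n
    have e : h = fun ω => limsup (fun k => (μ[f | m (ns (k + n))]) ω) atTop := by
      ext ω
      exact (limsup_nat_add (fun k => (μ[f | m (ns k)]) ω) n).symm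
    rw [e]
    refine (@Measurable.limsup ℝ Ω _ _ _ (m n) _ _ _ _ fun k => ?_) hs
    exact (stronglyMeasurable_condExp.mono
      (hanti ((Nat.le_add_left n k).trans (hns.id_le _)))).measurable
  have hle : ⨅ n, m n ≤ m0 := (iInf_le m 0).trans (hm 0)
  obtain ⟨c, hc⟩ : ∃ c, h =ᵐ[μ] fun _ => c := by
    refine exists_eventuallyEq_const_of_forall_separating MeasurableSet fun V hV => ?_
    rcases htriv _ (hmeas hV) with h0 | h1
    · right
      exact measure_eq_zero_iff_ae_notMem.1 h0
    · left
      exact (mem_ae_iff_prob_eq_one (hle _ (hmeas hV))).2 h1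
  have hgc : g =ᵐ[μ] fun _ => c := hh.trans hc
  have hlim' : Tendsto (fun n => eLpNorm (μ[f | m n] - fun _ => c) 2 μ) atTop (𝓝 0) :=
    hlim.congr fun n => eLpNorm_congr_ae (EventuallyEq.rfl.sub hgc)
  have hcf : ∫ ω, f ω ∂μ = c := by
    have hb : ∀ n, ENNReal.ofReal |∫ ω, f ω ∂μ - c| ≤ eLpNorm (μ[f | m n] - fun _ => c) 2 μ := by
      intro n
      have e : ∫ ω, f ω ∂μ - c = ∫ ω, ((μ[f | m n]) ω - c) ∂μ := by
        rw [integral_sub integrable_condExp (integrable_const c), integral_condExp (hm n)]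
        simp
      rw [e, ← Real.norm_eq_abs, ofReal_norm]
      refine (enorm_integral_le_lintegral_enorm _).trans ?_
      have := eLpNorm_le_eLpNorm_of_exponent_le (μ := μ) (p := 1) (q := 2) one_le_two
        ((hsm n).sub (aestronglyMeasurable_const (b := c)))
      rw [eLpNorm_one_eq_lintegral_enorm] at this
      exact this
    have := ge_of_tendsto' hlim' hb
    have := abs_nonpos_iff.1 (ENNReal.ofReal_eq_zero.1 (nonpos_iff_eq_zero.1 this))
    linarith
  rwa [hcf]

end ReverseMartingale

section Past

variable {E : Type*} [MeasurableSpace E]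

theorem IsTailTrivial.tendsto_condExp {P : Measure (ℤ → E)} [IsProbabilityMeasure P]
    (htail : IsTailTrivial P) {f : (ℤ → E) → ℝ} (hf : MemLp f 2 P) :
    Tendsto (fun n : ℕ => eLpNorm (P[f | pastSigma E (-n)] - fun _ => ∫ x, f x ∂P) 2 P) atTop
      (𝓝 0) := by
  refine tendsto_condExp_of_antitone_of_trivial (fun n => pastSigma_le _)
    (fun a b hab => pastSigma_mono (by omega)) (fun A hA => htail A ?_) hf
  refine (le_iInf fun i => ?_ : (⨅ n : ℕ, pastSigma E (-n)) ≤ ⨅ i : ℤ, pastSigma E i) _ hA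
  exact (iInf_le _ i.natAbs).trans (pastSigma_mono (by omega))

theorem iSup_pastSigma : ⨆ n : ℕ, pastSigma E n = MeasurableSpace.pi := by
  refine le_antisymm (iSup_le fun n => pastSigma_le _) (iSup_le fun k => ?_)
  refine le_trans ?_ (le_iSup _ k.natAbs)
  exact (measurable_coord_past (by omega)).comap_le

theorem tendsto_condExp_future {P : Measure (ℤ → E)} [IsProbabilityMeasure P]
    {f : (ℤ → E) → ℝ} (hfm : Measurable f) (hf : Integrable f P) :
    ∀ᵐ x ∂P, Tendsto (fun n : ℕ => (P[f | pastSigma E n]) x) atTop (𝓝 (f x)) := by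
  let ℱ : Filtration ℕ (MeasurableSpace.pi : MeasurableSpace (ℤ → E)) :=
    ⟨fun n => pastSigma E n, fun a b hab => pastSigma_mono (by exact_mod_cast hab),
      fun n => pastSigma_le _⟩
  refine hf.tendsto_ae_condExp (ℱ := ℱ) ?_
  have e : ⨆ n, ℱ n = MeasurableSpace.pi := iSup_pastSigma
  rw [e]
  exact hfm.stronglyMeasurable

/-- Along a subsequence, the increments of the martingale of conditional expectations given the
past recover the fluctuation of `f` around its mean. -/
theorem IsTailTrivial.exists_tendsto_sub {P : Measure (ℤ → E)} [IsProbabilityMeasure P]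
    (htail : IsTailTrivial P) {f : (ℤ → E) → ℝ} (hfm : Measurable f) (hf : MemLp f 2 P) :
    ∃ ns : ℕ → ℕ, ∀ᵐ x ∂P, Tendsto (fun k => (P[f | pastSigma E (ns k)]) x -
      (P[f | pastSigma E (-(ns k))]) x) atTop (𝓝 (f x - ∫ y, f y ∂P)) := by
  obtain ⟨ns, hns, hae⟩ := (tendstoInMeasure_of_tendsto_eLpNorm two_ne_zero
    (fun n => (stronglyMeasurable_condExp.mono (pastSigma_le _)).aestronglyMeasurable)
    aestronglyMeasurable_const (htail.tendsto_condExp hf)).exists_seq_tendsto_ae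
  refine ⟨ns, ?_⟩
  filter_upwards [hae, tendsto_condExp_future hfm (hf.integrable one_le_two)] with x h1 h2
  exact (h2.comp hns.tendsto_atTop).sub h1

end Past

/-! ### Coordinatewise Lipschitz functions and the coupling time -/

section Lipschitz

variable {E : Type*} [MetricSpace E]

theorem enorm_sub_le_lipConst (hdisc : ∀ x y : E, x ≠ y → dist x y = 1) (f : (ℤ → E) → ℝ) {i : ℤ}
    {x y : ℤ → E} (hxy : ∀ j, j ≠ i → x j = y j) : ‖f x - f y‖ₑ ≤ lipConst f i := by
  by_cases h : x i = y i
  · have : x = y := funext fun j => by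
      by_cases hj : j = i
      · rw [hj, h]
      · exact hxy j hj
    simp [this]
  · have key : ∀ {x y : ℤ → E}, (∀ j, j ≠ i → x j = y j) → x i ≠ y i →
        ENNReal.ofReal (f x - f y) ≤ lipConst f i := fun {x y} h1 h2 => by
      refine le_trans (le_of_eq ?_)
        (le_iSup_of_le x (le_iSup_of_le y (le_iSup_of_le h1 (le_iSup_of_le h2 le_rfl))))
      rw [hdisc _ _ h2, div_one]
    rw [Real.enorm_eq_ofReal_abs]
    rcases abs_choice (f x - f y) with h' | h' <;> rw [h']
    · exact key hxy h
    · rw [neg_sub]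
      exact key (fun j hj => (hxy j hj).symm) (Ne.symm h)

theorem enorm_sub_le_sum_lipConst (hdisc : ∀ x y : E, x ≠ y → dist x y = 1) (f : (ℤ → E) → ℝ)
    (S : Finset ℤ) {x y : ℤ → E} (hxy : ∀ j, j ∉ S → x j = y j) :
    ‖f x - f y‖ₑ ≤ ∑ i ∈ S, lipConst f i := by
  classical
  induction S using Finset.induction_on generalizing x with
  | empty => simp [funext fun j => hxy j (by simp)]
  | insert i S hi ih =>
    have h1 := enorm_sub_le_lipConst hdisc f (x := x) (y := Function.update x i (y i)) (i := i)
      fun j hj => by simp [hj]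
    have h2 := ih (x := Function.update x i (y i)) fun j hj => by
      by_cases h : j = i
      · subst h; simp
      · simp [h, hxy j (by simp [h, hj])]
    rw [Finset.sum_insert hi]
    calc ‖f x - f y‖ₑ
        = ‖(f x - f (Function.update x i (y i))) + (f (Function.update x i (y i)) - f y)‖ₑ := by
          congr 1; ring
      _ ≤ _ := (enorm_add_le _ _).trans (add_le_add h1 h2)

end Lipschitz

section CouplingTime

variable {E : Type*}

theorem couplingTime_le_iff {w : (ℕ → E) × (ℕ → E)} {k : ℕ} :
    couplingTime w ≤ k ↔ ∀ j, k ≤ j → w.1 j = w.2 j := by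
  constructor
  · intro h j hj
    have h' : couplingTime w < (k + 1 : ℕ) :=
      lt_of_le_of_lt h (by exact_mod_cast Nat.lt_succ_self k)
    simp only [couplingTime, iInf_lt_iff] at h'
    obtain ⟨l, hl, hlk⟩ := h'
    exact hl j ((Nat.lt_succ_iff.1 (by exact_mod_cast hlk)).trans hj)
  · exact fun h => iInf₂_le k h

theorem measurable_couplingTime [Countable E] [MeasurableSpace E] [DiscreteMeasurableSpace E] :
    Measurable (couplingTime : (ℕ → E) × (ℕ → E) → ℕ∞) := by
  have hle : ∀ k : ℕ, MeasurableSet {w : (ℕ → E) × (ℕ → E) | couplingTime w ≤ k} := fun k => by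
    simp only [couplingTime_le_iff, Set.ofPred_forall]
    exact MeasurableSet.iInter fun j => .iInter fun _ => by measurability
  refine measurable_to_countable' fun a => ?_
  induction a using ENat.recTopCoe with
  | top =>
    have : couplingTime ⁻¹' {⊤} = ⋂ k : ℕ, {w : (ℕ → E) × (ℕ → E) | couplingTime w ≤ k}ᶜ := by
      ext w
      simp [ENat.eq_top_iff_forall_gt]
    rw [this]
    exact MeasurableSet.iInter fun k => (hle k).compl
  | coe k =>
    have : couplingTime ⁻¹' {(k : ℕ∞)} = {w : (ℕ → E) × (ℕ → E) | couplingTime w ≤ k} ∩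
        ⋂ l : ℕ, ⋂ _ : l < k, {w : (ℕ → E) × (ℕ → E) | couplingTime w ≤ l}ᶜ := by
      ext w
      simp only [Set.mem_preimage, Set.mem_singleton_iff, Set.mem_inter_iff, Set.mem_ofPred_eq,
        Set.mem_iInter, Set.mem_compl_iff, not_le]
      refine ⟨fun h => ⟨h.le, fun l hl => by rw [h]; exact_mod_cast hl⟩, fun h => ?_⟩
      refine le_antisymm h.1 (not_lt.1 fun hlt => ?_)
      obtain ⟨l, hl⟩ := ENat.ne_top_iff_exists.1 (hlt.trans_le le_top).ne
      rw [← hl] at hlt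
      exact absurd (h.2 l (by exact_mod_cast hlt)) (by simp [← hl])
    rw [this]
    exact (hle k).inter (MeasurableSet.iInter fun l => .iInter fun _ => (hle l).compl)

/-- Two trajectories glued to the same past differ at the times before the coupling time only. -/
theorem enorm_sub_glue_le [MetricSpace E] (hdisc : ∀ x y : E, x ≠ y → dist x y = 1)
    (f : (ℤ → E) → ℝ) (i : ℤ) (x : ℤ → E) {w : (ℕ → E) × (ℕ → E)} (hw : couplingTime w ≠ ⊤) :
    ‖f (glue i x w.1) - f (glue i x w.2)‖ₑ ≤
      ∑' k : ℕ, lipConst f (i + k) *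
        {w : (ℕ → E) × (ℕ → E) | (k : ℕ∞) < couplingTime w}.indicator 1 w := by
  classical
  obtain ⟨N, hN⟩ := ENat.ne_top_iff_exists.1 hw
  have hag := couplingTime_le_iff.1 hN.symm.le
  have inj : Function.Injective fun k : ℕ => i + k := fun a b h => by simpa using h
  calc _ ≤ ∑ j ∈ (Finset.range N).image (fun k : ℕ => i + k), lipConst f j := by
        refine enorm_sub_le_sum_lipConst hdisc f _ fun j hj => ?_
        rcases lt_or_ge j i with h | h
        · rw [glue_of_lt h, glue_of_lt h]
        · obtain ⟨k, rfl⟩ := Int.le.dest h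
          rw [glue_add, glue_add]
          refine hag k (not_lt.1 fun hk => hj ?_)
          exact Finset.mem_image.2 ⟨k, Finset.mem_range.2 hk, rfl⟩
    _ = ∑ k ∈ Finset.range N, lipConst f (i + k) := Finset.sum_image fun a _ b _ h => inj h
    _ = ∑ k ∈ Finset.range N, lipConst f (i + k) *
        {w : (ℕ → E) × (ℕ → E) | (k : ℕ∞) < couplingTime w}.indicator 1 w := by
        refine Finset.sum_congr rfl fun k hk => ?_
        rw [Set.indicator_of_mem]
        · simp
        · rw [Set.mem_ofPred_eq, ← hN]; exact_mod_cast Finset.mem_range.1 hk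
    _ ≤ _ := ENNReal.sum_le_tsum _

end CouplingTime

/-! ### Moments of the coupling time -/

/-- Cauchy–Schwarz for sequences in `[0, ∞]`. -/
theorem tsum_mul_sq_le (a b : ℕ → ℝ≥0∞) :
    (∑' k, a k * b k) ^ 2 ≤ (∑' k, a k ^ 2) * ∑' k, b k ^ 2 := by
  have h := ENNReal.lintegral_mul_le_Lp_mul_Lq (Measure.count : Measure ℕ) Real.HolderConjugate.two_two
    (f := a) (g := b) (measurable_of_countable _).aemeasurable
    (measurable_of_countable _).aemeasurable
  simp only [lintegral_count, Pi.mul_apply, ENNReal.rpow_two] at h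
  calc _ ≤ ((∑' k, a k ^ 2) ^ (1 / 2 : ℝ) * (∑' k, b k ^ 2) ^ (1 / 2 : ℝ)) ^ 2 := by gcongr
    _ = _ := by
      rw [mul_pow, ← ENNReal.rpow_two, ← ENNReal.rpow_two, ← ENNReal.rpow_mul, ← ENNReal.rpow_mul]
      norm_num

/-- The bound on `∑ (k + 1) ^ (1 + ε)` over `k < min m m'`, split between `m` and `m'`. -/
theorem tsum_indicator_le {ε : ℝ} (hε : 0 ≤ ε) (m m' : ℕ∞) :
    ∑' k : ℕ, ((k : ℝ≥0∞) + 1) ^ (1 + ε) *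
        ((if (k : ℕ∞) < m then 1 else 0) * (if (k : ℕ∞) < m' then 1 else 0)) ≤
      1 / 2 * (((m : ℝ≥0∞) + 1) ^ (1 + ε / 2) * ((m' : ℝ≥0∞) + 1) ^ (1 + ε / 2)) := by
  have he : 0 < 1 + ε / 2 := by linarith
  wlog hmm : m ≤ m' generalizing m m'
  · have := this m' m (not_le.1 hmm).le
    simp only [mul_comm (if (_ : ℕ∞) < m then (1 : ℝ≥0∞) else 0)]
    rwa [mul_comm (((m : ℝ≥0∞) + 1) ^ (1 + ε / 2))]
  induction m using ENat.recTopCoe with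
  | top =>
    rw [top_le_iff.1 hmm]
    simp [ENNReal.top_rpow_of_pos he, ENNReal.mul_top]
  | coe N =>
    calc _ ≤ ∑' k : ℕ, (if k < N then ENNReal.ofReal (((k : ℝ) + 1) ^ (1 + ε)) else 0) := by
          refine ENNReal.tsum_le_tsum fun k => ?_
          by_cases h : k < N
          · rw [if_pos (by exact_mod_cast h), if_pos h]
            have : ENNReal.ofReal (((k : ℝ) + 1) ^ (1 + ε)) = ((k : ℝ≥0∞) + 1) ^ (1 + ε) := by
              rw [← ENNReal.ofReal_rpow_of_pos (by positivity),
                ENNReal.ofReal_add (by positivity) (by positivity)]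
              simp
            rw [this]
            refine mul_le_of_le_one_right zero_le ?_
            split_ifs <;> simp
          · rw [if_neg (by exact_mod_cast h)]; simp
      _ = ENNReal.ofReal (∑ k ∈ Finset.range N, ((k : ℝ) + 1) ^ (1 + ε)) := by
          rw [tsum_eq_sum (s := Finset.range N) fun k hk => if_neg (by simpa using hk),
            ENNReal.ofReal_sum_of_nonneg fun k _ => by positivity]
          exact Finset.sum_congr rfl fun k hk => if_pos (Finset.mem_range.1 hk)
      _ ≤ ENNReal.ofReal ((1 / 2) * ((N : ℝ) + 1) ^ (2 + ε)) :=
          ENNReal.ofReal_le_ofReal (sum_pow_le hε N)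
      _ = 1 / 2 * ((((N : ℕ∞) : ℝ≥0∞) + 1) ^ (1 + ε / 2) *
            (((N : ℕ∞) : ℝ≥0∞) + 1) ^ (1 + ε / 2)) := by
          rw [← ENNReal.rpow_add_of_nonneg _ _ he.le he.le, ENNReal.ofReal_mul (by norm_num),
            ← ENNReal.ofReal_rpow_of_pos (by positivity),
            ENNReal.ofReal_add (by positivity) (by positivity)]
          congr 2
          · rw [ENNReal.ofReal_div_of_pos (by norm_num)]; simp
          · simp
          · ring
      _ ≤ _ := by
          gcongr

/-- The square of a tail probability of `T` is the probability that two independent copies of `T`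
both exceed `k`, so the series is an expectation to which `tsum_indicator_le` applies. -/
theorem tsum_measure_sq_le {Ω : Type*} [MeasurableSpace Ω] (ρ : Measure Ω) [SFinite ρ] {T : Ω → ℕ∞}
    (hT : Measurable T) {ε : ℝ} (hε : 0 ≤ ε) :
    ∑' k : ℕ, ((k : ℝ≥0∞) + 1) ^ (1 + ε) * ρ {ω | (k : ℕ∞) < T ω} ^ 2 ≤
      1 / 2 * (∫⁻ ω, ((T ω : ℝ≥0∞) + 1) ^ (1 + ε / 2) ∂ρ) ^ 2 := by
  have hm : ∀ k : ℕ, Measurable fun ω => if (k : ℕ∞) < T ω then (1 : ℝ≥0∞) else 0 := fun k =>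
    Measurable.ite (hT (.of_discrete (s := Set.Ioi (k : ℕ∞)))) measurable_const measurable_const
  have hg : Measurable fun ω => ((T ω : ℝ≥0∞) + 1) ^ (1 + ε / 2) :=
    (measurable_of_countable fun t : ℕ∞ => ((t : ℝ≥0∞) + 1) ^ (1 + ε / 2)).comp hT
  have hk : ∀ k : ℕ, ρ {ω | (k : ℕ∞) < T ω} = ∫⁻ ω, (if (k : ℕ∞) < T ω then 1 else 0) ∂ρ := fun k => by
    have : ∀ ω, (if (k : ℕ∞) < T ω then (1 : ℝ≥0∞) else 0) =
        {ω | (k : ℕ∞) < T ω}.indicator 1 ω := fun ω => by simp [Set.indicator]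
    rw [lintegral_congr this]
    exact (lintegral_indicator_one (hT (.of_discrete (s := Set.Ioi (k : ℕ∞))))).symm
  calc _ = ∑' k : ℕ, ∫⁻ ω, ∫⁻ ω', ((k : ℝ≥0∞) + 1) ^ (1 + ε) *
        ((if (k : ℕ∞) < T ω then 1 else 0) * (if (k : ℕ∞) < T ω' then 1 else 0)) ∂ρ ∂ρ := by
        refine tsum_congr fun k => ?_
        have e1 : ∀ ω, ∫⁻ ω', ((k : ℝ≥0∞) + 1) ^ (1 + ε) *
            ((if (k : ℕ∞) < T ω then 1 else 0) * (if (k : ℕ∞) < T ω' then 1 else 0)) ∂ρ =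
            ((k : ℝ≥0∞) + 1) ^ (1 + ε) * ((if (k : ℕ∞) < T ω then 1 else 0) *
              ρ {ω | (k : ℕ∞) < T ω}) := fun ω => by
          rw [lintegral_const_mul _ ((hm k).const_mul _), lintegral_const_mul _ (hm k), hk k]
        rw [lintegral_congr e1, lintegral_const_mul _ ((hm k).mul_const _),
          lintegral_mul_const _ (hm k), ← hk k, sq]
    _ = ∫⁻ ω, ∫⁻ ω', ∑' k : ℕ, ((k : ℝ≥0∞) + 1) ^ (1 + ε) *
        ((if (k : ℕ∞) < T ω then 1 else 0) * (if (k : ℕ∞) < T ω' then 1 else 0)) ∂ρ ∂ρ := by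
        rw [← lintegral_tsum fun k => ?_]
        · refine lintegral_congr fun ω => ?_
          rw [← lintegral_tsum fun k => ?_]
          exact (((hm k).const_mul _).const_mul _).aemeasurable
        · refine (Measurable.lintegral_prod_right' (f := fun q : Ω × Ω => ((k : ℝ≥0∞) + 1) ^ (1 + ε) *
            ((if (k : ℕ∞) < T q.1 then 1 else 0) * (if (k : ℕ∞) < T q.2 then 1 else 0)))
            ?_).aemeasurable
          exact (((hm k).comp measurable_fst).mul ((hm k).comp measurable_snd)).const_mul _
    _ ≤ ∫⁻ ω, ∫⁻ ω', 1 / 2 * (((T ω : ℝ≥0∞) + 1) ^ (1 + ε / 2) *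
          ((T ω' : ℝ≥0∞) + 1) ^ (1 + ε / 2)) ∂ρ ∂ρ :=
        lintegral_mono fun ω => lintegral_mono fun ω' => tsum_indicator_le hε _ _
    _ = _ := by
        have e1 : ∀ ω, ∫⁻ ω', 1 / 2 * (((T ω : ℝ≥0∞) + 1) ^ (1 + ε / 2) *
            ((T ω' : ℝ≥0∞) + 1) ^ (1 + ε / 2)) ∂ρ = 1 / 2 * (((T ω : ℝ≥0∞) + 1) ^ (1 + ε / 2) *
              ∫⁻ ω', ((T ω' : ℝ≥0∞) + 1) ^ (1 + ε / 2) ∂ρ) := fun ω => by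
          rw [lintegral_const_mul _ (hg.const_mul _), lintegral_const_mul _ hg]
        rw [lintegral_congr e1, lintegral_const_mul _ (hg.mul_const _), lintegral_mul_const _ hg, sq]

/-- Cauchy–Schwarz with the weights `(k + 1) ^ (1 + ε)`. -/
theorem tsum_mul_measure_sq_le {Ω : Type*} [MeasurableSpace Ω] (ρ : Measure Ω) [SFinite ρ]
    {T : Ω → ℕ∞} (hT : Measurable T) {ε : ℝ} (hε : 0 ≤ ε) (a : ℕ → ℝ≥0∞) :
    (∑' k : ℕ, a k * ρ {ω | (k : ℕ∞) < T ω}) ^ 2 ≤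
      (∑' k : ℕ, a k ^ 2 * (1 / ((k : ℝ≥0∞) + 1)) ^ (1 + ε)) *
        (1 / 2 * (∫⁻ ω, ((T ω : ℝ≥0∞) + 1) ^ (1 + ε / 2) ∂ρ) ^ 2) := by
  let v : ℕ → ℝ≥0∞ := fun k => ((k : ℝ≥0∞) + 1) ^ ((1 + ε) / 2)
  have hk0 : ∀ k : ℕ, (k : ℝ≥0∞) + 1 ≠ 0 := fun k => by simp
  have hkt : ∀ k : ℕ, (k : ℝ≥0∞) + 1 ≠ ∞ := fun k => by simp
  have hv0 : ∀ k, v k ≠ 0 := fun k => (ENNReal.rpow_pos (pos_iff_ne_zero.2 (hk0 k)) (hkt k)).ne'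
  have hvt : ∀ k, v k ≠ ∞ := fun k => ENNReal.rpow_ne_top_of_nonneg (by positivity) (hkt k)
  have hv2 : ∀ k, v k ^ 2 = ((k : ℝ≥0∞) + 1) ^ (1 + ε) := fun k => by
    rw [← ENNReal.rpow_two, ← ENNReal.rpow_mul]; congr 1; ring
  have hvi : ∀ k, ((v k)⁻¹) ^ 2 = (1 / ((k : ℝ≥0∞) + 1)) ^ (1 + ε) := fun k => by
    rw [one_div, ENNReal.inv_rpow, ← hv2, ENNReal.inv_pow]
  calc _ = (∑' k : ℕ, (a k * (v k)⁻¹) * (v k * ρ {ω | (k : ℕ∞) < T ω})) ^ 2 := by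
        congr 1
        refine tsum_congr fun k => ?_
        rw [mul_assoc, ← mul_assoc (v k)⁻¹, ENNReal.inv_mul_cancel (hv0 k) (hvt k), one_mul]
    _ ≤ (∑' k : ℕ, (a k * (v k)⁻¹) ^ 2) * ∑' k : ℕ, (v k * ρ {ω | (k : ℕ∞) < T ω}) ^ 2 :=
        tsum_mul_sq_le _ _
    _ ≤ _ := by
        simp only [mul_pow, hvi, hv2]
        gcongr
        exact tsum_measure_sq_le ρ hT hε

/-! ### The coupling of the chains started afresh and after one jump -/

section JumpCoupling

variable {E : Type*} [MeasurableSpace E] [DiscreteMeasurableSpace E]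

/-- The law of the chain started from `z`, as a kernel. It is read off from the coupling of the
chain with itself. -/
noncomputable def chainKernel (Phat : E → E → Measure ((ℕ → E) × (ℕ → E))) : Kernel E (ℕ → E) where
  toFun z := (Phat z z).map Prod.fst
  measurable' := .of_discrete

/-- The given couplings of the chain started from `b` with the chain started from `z`, as a kernel
in `z`. -/
noncomputable def couplingKernel (Phat : E → E → Measure ((ℕ → E) × (ℕ → E))) (b : E) :
    Kernel E ((ℕ → E) × (ℕ → E)) where
  toFun z := Phat b z
  measurable' := .of_discrete

/-- A coupling of the chain started from `b` with the chain whose initial state is a jump of `κ`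
from `a`: the initial state `z` of the second chain has law `κ a`, and given `z` the pair has law
`Phat b z`. -/
noncomputable def jumpCoupling (κ : Kernel E E) (Phat : E → E → Measure ((ℕ → E) × (ℕ → E)))
    (a b : E) : Measure ((ℕ → E) × (ℕ → E)) :=
  couplingKernel Phat b ∘ₘ κ a

variable {κ : Kernel E E} {Phat : E → E → Measure ((ℕ → E) × (ℕ → E))}

theorem IsChainCoupling.isMarkovLaw_chainKernel (h : IsChainCoupling κ Phat) (z : E) :
    IsMarkovLaw κ (Measure.dirac z) (chainKernel Phat z) := h.left z z

variable [Countable E]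

theorem IsChainCoupling.isMarkovKernel_chainKernel (h : IsChainCoupling κ Phat) :
    IsMarkovKernel (chainKernel Phat) :=
  ⟨fun z => (h.isMarkovLaw_chainKernel z).isProbabilityMeasure⟩

theorem IsChainCoupling.isMarkovKernel_couplingKernel (h : IsChainCoupling κ Phat) (b : E) :
    IsMarkovKernel (couplingKernel Phat b) :=
  ⟨fun z => h.isProbabilityMeasure b z⟩

/-- The first marginal of every coupling started from `b` is the law of the chain from `b`. -/
theorem IsChainCoupling.map_fst (h : IsChainCoupling κ Phat) (b z : E) :
    (Phat b z).map Prod.fst = chainKernel Phat b := by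
  have := (h.left b z).isProbabilityMeasure
  have := h.isMarkovKernel_chainKernel
  exact (h.left b z).ext (h.isMarkovLaw_chainKernel b)

theorem IsChainCoupling.map_snd (h : IsChainCoupling κ Phat) (b z : E) :
    (Phat b z).map Prod.snd = chainKernel Phat z := by
  have := (h.right b z).isProbabilityMeasure
  have := h.isMarkovKernel_chainKernel
  exact (h.right b z).ext (h.isMarkovLaw_chainKernel z)

theorem IsChainCoupling.jumpCoupling_map_fst [IsMarkovKernel κ] (h : IsChainCoupling κ Phat)
    (a b : E) : (jumpCoupling κ Phat a b).map Prod.fst = chainKernel Phat b := by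
  rw [jumpCoupling, Measure.map_comp _ _ measurable_fst]
  ext S hS
  rw [Measure.bind_apply hS (Kernel.aemeasurable _)]
  have : ∀ z, ((couplingKernel Phat b).map Prod.fst) z S = chainKernel Phat b S := fun z => by
    rw [Kernel.map_apply _ measurable_fst, ← h.map_fst b z]; rfl
  simp [this]

theorem IsChainCoupling.jumpCoupling_map_snd [IsMarkovKernel κ] (h : IsChainCoupling κ Phat)
    (a b : E) : (jumpCoupling κ Phat a b).map Prod.snd = (chainKernel Phat ∘ₖ κ) a := by
  rw [jumpCoupling, Measure.map_comp _ _ measurable_snd, Kernel.comp_apply]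
  congr 1
  ext z : 1
  rw [Kernel.map_apply _ measurable_snd, ← h.map_snd b z]; rfl

/-- The conditional coupling moment `∑ z, κ(a, z) Ê_{b,z} (T + 1) ^ (1 + ε / 2)`, which controls the
martingale increment at a time at which the chain moves from `a` to `b`. -/
noncomputable def jumpMoment (κ : Kernel E E) (Phat : E → E → Measure ((ℕ → E) × (ℕ → E))) (ε : ℝ)
    (a b : E) : ℝ≥0∞ :=
  ∑' z : E, κ a {z} * couplingMoment Phat ε b z

theorem lintegral_jumpCoupling (ε : ℝ) (a b : E) :
    ∫⁻ w, ((couplingTime w : ℝ≥0∞) + 1) ^ (1 + ε / 2) ∂(jumpCoupling κ Phat a b) =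
      jumpMoment κ Phat ε a b := by
  have hg : Measurable fun w : (ℕ → E) × (ℕ → E) => ((couplingTime w : ℝ≥0∞) + 1) ^ (1 + ε / 2) :=
    (measurable_of_countable fun t : ℕ∞ => ((t : ℝ≥0∞) + 1) ^ (1 + ε / 2)).comp
      measurable_couplingTime
  rw [jumpCoupling, Measure.lintegral_bind (Kernel.aemeasurable _) hg.aemeasurable,
    lintegral_countable']
  exact tsum_congr fun z => mul_comm _ _

/-- A finite coupling moment forces the coupling to be successful. -/
theorem ae_couplingTime_ne_top {ε : ℝ} (hε : 0 < ε) {a b : E} (h : jumpMoment κ Phat ε a b ≠ ∞) :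
    ∀ᵐ w ∂(jumpCoupling κ Phat a b), couplingTime w ≠ ⊤ := by
  rw [← lintegral_jumpCoupling] at h
  have hg : Measurable fun w : (ℕ → E) × (ℕ → E) => ((couplingTime w : ℝ≥0∞) + 1) ^ (1 + ε / 2) :=
    (measurable_of_countable fun t : ℕ∞ => ((t : ℝ≥0∞) + 1) ^ (1 + ε / 2)).comp
      measurable_couplingTime
  filter_upwards [ae_lt_top hg h] with w hw hT
  rw [hT] at hw
  simp [ENNReal.top_rpow_of_pos (by linarith : 0 < 1 + ε / 2)] at hw

variable {ν : Measure E} {P : Measure (ℤ → E)} [IsProbabilityMeasure P]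

/-- The martingale increment at time `i` is an average, under the coupling, of differences of `f`
along trajectories that agree before time `i`. -/
theorem condExp_sub_eq_integral [IsMarkovKernel κ] (hP : IsStationaryMarkov κ ν P)
    (hPhat : IsChainCoupling κ Phat) {f : (ℤ → E) → ℝ} (hfm : Measurable f) (hf : Integrable f P)
    (i : ℤ) : ∀ᵐ x ∂P, (P[f | pastSigma E i]) x - (P[f | pastSigma E (i - 1)]) x =
      ∫ w, (f (glue i x w.1) - f (glue i x w.2)) ∂(jumpCoupling κ Phat (x (i - 1)) (x i)) := by
  have := hPhat.isMarkovKernel_chainKernel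
  obtain ⟨h1, h2⟩ := hP.condExp_self hPhat.isMarkovLaw_chainKernel i hfm hf
  obtain ⟨h3, h4⟩ := hP.condExp_pred hPhat.isMarkovLaw_chainKernel i hfm hf
  filter_upwards [h1, h2, h3, h4] with x hx1 hx2 hx3 hx4
  have hgm : Measurable fun u => f (glue i x u) :=
    hfm.comp ((measurable_glue i).comp (measurable_const.prodMk measurable_id))
  rw [← hPhat.jumpCoupling_map_fst (x (i - 1)) (x i)] at hx1 hx2
  rw [← hPhat.jumpCoupling_map_snd (x (i - 1)) (x i)] at hx3 hx4
  rw [integral_map (by fun_prop) hgm.aestronglyMeasurable] at hx2 hx4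
  rw [hx2, hx4, integral_sub]
  · exact (integrable_map_measure hgm.aestronglyMeasurable (by fun_prop)).1 hx1
  · exact (integrable_map_measure hgm.aestronglyMeasurable (by fun_prop)).1 hx3

end JumpCoupling

/-! ### Functions without coordinatewise oscillation -/

section Mixing

variable {E : Type*} [Countable E] [MeasurableSpace E] [DiscreteMeasurableSpace E]
variable {κ : Kernel E E} {ν : Measure E} {P : Measure (ℤ → E)}

theorem IsStationaryMarkov.measure_coord (hP : IsStationaryMarkov κ ν P) (i : ℤ) (a : E) :
    P {x | x i = a} = ν {a} := by
  simpa using hP.cylinder i 0 (fun _ => a)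

theorem IsStationaryMarkov.measure_pair (hP : IsStationaryMarkov κ ν P) (i : ℤ) (a b : E) :
    P {x | x (i - 1) = a ∧ x i = b} = ν {a} * κ a {b} := by
  have h := hP.cylinder (i - 1) 1 (fun k => if k = 0 then a else b)
  simp only [zero_add, Finset.range_one, Finset.prod_singleton, if_true, one_ne_zero, if_false] at h
  rw [← h]
  congr 1 with x
  simp only [Set.mem_ofPred_eq]
  constructor
  · rintro ⟨h1, h2⟩ k hk
    interval_cases k
    · simpa using h1
    · simpa using h2
  · intro hx
    exact ⟨by simpa using hx 0 (by norm_num), by simpa using hx 1 le_rfl⟩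

theorem IsStationaryMarkov.lintegral_pair (hP : IsStationaryMarkov κ ν P) (i : ℤ)
    (g : E → E → ℝ≥0∞) :
    ∫⁻ x, g (x (i - 1)) (x i) ∂P = ∑' (a : E) (b : E), ν {a} * κ a {b} * g a b := by
  have hm : Measurable fun x : ℤ → E => (x (i - 1), x i) := by fun_prop
  rw [← lintegral_map (f := fun q : E × E => g q.1 q.2) (measurable_of_countable _) hm,
    lintegral_countable', ENNReal.tsum_prod']
  refine tsum_congr fun a => tsum_congr fun b => ?_
  rw [Measure.map_apply hm (measurableSet_singleton _), mul_comm, ← hP.measure_pair i a b]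
  congr 2 with x
  simp

theorem IsStationaryMarkov.ae_coord_ne_zero (hP : IsStationaryMarkov κ ν P) (i : ℤ) :
    ∀ᵐ x ∂P, ν {x i} ≠ 0 := by
  have : {x : ℤ → E | ¬ ν {x i} ≠ 0} ⊆ ⋃ a ∈ {a : E | ν {a} = 0}, {x : ℤ → E | x i = a} := by
    intro x hx
    simpa using hx
  refine measure_mono_null this ((measure_biUnion_null_iff (Set.to_countable _)).2 fun a ha => ?_)
  rw [hP.measure_coord]; exact ha

/-- The chain does not leave the support of its stationary distribution. -/
theorem IsStationaryMarkov.ae_kernel_ne_zero (hP : IsStationaryMarkov κ ν P) {a : E}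
    (ha : ν {a} ≠ 0) : ∀ᵐ z ∂(κ a), ν {z} ≠ 0 := by
  have : {z : E | ¬ ν {z} ≠ 0} = ⋃ b ∈ {b : E | ν {b} = 0}, {b} := by ext; simp
  rw [ae_iff, this, measure_biUnion_null_iff (Set.to_countable _)]
  intro b hb
  have h1 := hP.measure_pair 0 a b
  have h2 : P {x | x (0 - 1) = a ∧ x 0 = b} ≤ ν {b} := by
    rw [← hP.measure_coord 0 b]
    exact measure_mono fun x hx => hx.2
  rw [h1, hb, nonpos_iff_eq_zero, mul_eq_zero] at h2
  exact h2.resolve_left ha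

theorem IsStationaryMarkov.measure_real_pair_shift (hP : IsStationaryMarkov κ ν P) (n : ℕ)
    (a b : E) : P.real {x | x n = b ∧ x 0 = a} = P.real {x | x 0 = b ∧ x (-n) = a} := by
  have hS : MeasurableSet {x : ℤ → E | x n = b ∧ x 0 = a} := by measurability
  rw [Measure.real, ← hP.map_shift (-n), Measure.map_apply (by fun_prop) hS, hP.map_shift]
  simp [Measure.real]

/-- Tail triviality of the past makes the chain mixing. -/
theorem IsTailTrivial.tendsto_measure_pair [IsProbabilityMeasure P]
    (hP : IsStationaryMarkov κ ν P) (htail : IsTailTrivial P) (a b : E) :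
    Tendsto (fun n : ℕ => P.real {x | x n = b ∧ x 0 = a}) atTop (𝓝 (ν.real {a} * ν.real {b})) := by
  let B : Set (ℤ → E) := {x | x 0 = b}
  have hB : MeasurableSet B := by measurability
  let f : (ℤ → E) → ℝ := B.indicator fun _ => 1
  have hf : MemLp f 2 P := (memLp_const (1 : ℝ)).indicator hB
  have hfi : Integrable f P := hf.integrable one_le_two
  have hc : ∫ x, f x ∂P = ν.real {b} := by
    rw [integral_indicator hB, setIntegral_const, smul_eq_mul, mul_one, Measure.real,
      hP.measure_coord 0 b]; rfl
  have hlim := htail.tendsto_condExp hf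
  rw [hc] at hlim
  rw [tendsto_iff_dist_tendsto_zero]
  have hlim' := (ENNReal.tendsto_toReal ENNReal.zero_ne_top).comp hlim
  refine squeeze_zero (fun _ => dist_nonneg) (fun n => ?_) hlim'
  let A : Set (ℤ → E) := {x | x (-n) = a}
  have hA' : MeasurableSet[pastSigma E (-n)] A :=
    measurable_coord_past (E := E) (le_refl (-(n : ℤ))) (measurableSet_singleton a)
  have hA := pastSigma_le _ A hA'
  have e1 : P.real {x | x n = b ∧ x 0 = a} = ∫ x in A, (P[f | pastSigma E (-n)]) x ∂P := by
    rw [hP.measure_real_pair_shift, setIntegral_condExp (pastSigma_le _) hfi hA',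
      setIntegral_indicator hB, setIntegral_const, smul_eq_mul, mul_one, Set.inter_comm]
    rfl
  have e2 : ν.real {a} * ν.real {b} = ∫ x in A, ν.real {b} ∂P := by
    rw [setIntegral_const, smul_eq_mul, Measure.real, Measure.real, Measure.real,
      hP.measure_coord (-n) a]
  have hsm : AEStronglyMeasurable (P[f | pastSigma E (-n)] - fun _ => ν.real {b}) P :=
    ((stronglyMeasurable_condExp.mono (pastSigma_le _)).aestronglyMeasurable).sub
      aestronglyMeasurable_const
  rw [Real.dist_eq, e1, e2, ← integral_sub integrable_condExp.integrableOn
    (integrable_const _).integrableOn, ← Real.norm_eq_abs]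
  have hmem : MemLp (P[f | pastSigma E (-n)] - fun _ => ν.real {b}) 2 P :=
    (hf.condExp one_le_two).sub (memLp_const _)
  refine (norm_integral_le_lintegral_norm _).trans ?_
  refine ENNReal.toReal_mono hmem.2.ne ?_
  refine le_trans ?_ (eLpNorm_le_eLpNorm_of_exponent_le (p := 1) one_le_two hsm)
  rw [eLpNorm_one_eq_lintegral_enorm]
  refine (setLIntegral_le_lintegral _ _).trans (le_of_eq ?_)
  exact lintegral_congr fun x => ofReal_norm _

/-- The expectation of a bounded function of the remote future of the chain does not depend on the
initial state, as long as the latter is charged by the stationary distribution. -/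
theorem IsTailTrivial.integral_eq_of_remote [IsProbabilityMeasure ν] [IsProbabilityMeasure P]
    (hP : IsStationaryMarkov κ ν P) (htail : IsTailTrivial P) {Q : Kernel E (ℕ → E)}
    [IsMarkovKernel Q] (hQ : ∀ z, IsMarkovLaw κ (Measure.dirac z) (Q z)) {r : (ℕ → E) → ℝ}
    (hrm : Measurable r) {C : ℝ} (hrC : ∀ u, ‖r u‖ ≤ C)
    (hinv : ∀ (u v : ℕ → E) (N : ℕ), (∀ k, N ≤ k → u k = v k) → r u = r v) {a a' : E}
    (ha : ν {a} ≠ 0) (ha' : ν {a'} ≠ 0) : ∫ u, r u ∂(Q a) = ∫ u, r u ∂(Q a') := by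
  -- `rn n` is `r` as a function of the trajectory from time `n` on. The earlier states are
  -- irrelevant and are filled with `a`.
  let rn : ℕ → (ℕ → E) → ℝ := fun n u => r fun k => if k < n then a else u (k - n)
  let h : ℕ → E → ℝ := fun n b => ∫ u, rn n u ∂(Q b)
  have hC : ∀ n b, ‖h n b‖ ≤ C := fun n b => by
    refine (norm_integral_le_of_norm_le_const (ae_of_all _ fun u => hrC _)).trans (le_of_eq ?_)
    simp
  have hGm : Measurable fun y : ℤ → E => r fun k : ℕ => y k := hrm.comp (by fun_prop)
  have hGi : Integrable (fun y : ℤ → E => r fun k : ℕ => y k) P :=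
    Integrable.of_bound hGm.aestronglyMeasurable C (ae_of_all _ fun y => hrC _)
  have hsumν : Summable fun b => ν.real {b} := by
    refine ENNReal.summable_toReal ?_
    have := Measure.tsum_indicator_apply_singleton ν Set.univ MeasurableSet.univ
    simp only [Set.indicator_univ] at this
    rw [this]; exact measure_ne_top _ _
  -- By the Markov property at time `n` and mixing, the expectation from `x` is asymptotic to an
  -- expression that does not involve `x`.
  have key : ∀ x : E, ν {x} ≠ 0 →
      Tendsto (fun n => ∫ u, r u ∂(Q x) - ∑' b, ν.real {b} * h n b) atTop (𝓝 0) := by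
    intro x hx
    have hx0 : ν.real {x} ≠ 0 := ENNReal.toReal_ne_zero.2 ⟨hx, measure_ne_top _ _⟩
    let A : Set (ℤ → E) := {y | y 0 = x}
    have hA : MeasurableSet A := by measurability
    have hA' : ∀ n : ℕ, MeasurableSet[pastSigma E n] A := fun n =>
      measurable_coord_past (E := E) (Int.natCast_nonneg n) (measurableSet_singleton x)
    have e0 : ∫ y in A, (r fun k : ℕ => y k) ∂P = ν.real {x} * ∫ u, r u ∂(Q x) := by
      rw [← setIntegral_condExp (pastSigma_le _) hGi (hA' 0),
        setIntegral_congr_ae (g := fun _ => ∫ u, r u ∂(Q x)) hA]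
      · rw [setIntegral_const, smul_eq_mul, Measure.real, hP.measure_coord 0 x]; rfl
      · filter_upwards [(hP.condExp_self hQ ((0 : ℕ) : ℤ) hGm hGi).2] with y hy hyA
        rw [hy]
        have : y ((0 : ℕ) : ℤ) = x := hyA
        rw [this]
        refine integral_congr_ae (ae_of_all _ fun u => congrArg r (funext fun k => ?_))
        simpa using glue_add ((0 : ℕ) : ℤ) y u k
    have e1 : ∀ n : ℕ, ∫ y in A, (r fun k : ℕ => y k) ∂P =
        ∑' b, P.real {y | y n = b ∧ y 0 = x} * h n b := fun n => by
      rw [← setIntegral_condExp (pastSigma_le _) hGi (hA' n),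
        setIntegral_congr_ae (g := fun y => h n (y n)) hA]
      · have : IsFiniteMeasure (P.restrict A) := inferInstance
        have hmeas : Measurable fun y : ℤ → E => y n := by fun_prop
        have hi : Integrable (h n) ((P.restrict A).map fun y : ℤ → E => y n) :=
          Integrable.of_bound (Measurable.of_discrete).aestronglyMeasurable C
            (ae_of_all _ fun b => hC n b)
        rw [← integral_map (φ := fun y : ℤ → E => y n) hmeas.aemeasurable hi.1,
          integral_countable hi]
        refine tsum_congr fun b => ?_
        rw [smul_eq_mul, Measure.real, Measure.map_apply hmeas (measurableSet_singleton b),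
          Measure.restrict_apply (hmeas (measurableSet_singleton b))]
        rfl
      · filter_upwards [(hP.condExp_self hQ (n : ℤ) hGm hGi).2] with y hy hyA
        rw [hy]
        refine integral_congr_ae (ae_of_all _ fun u => ?_)
        refine hinv _ _ n fun k hk => ?_
        obtain ⟨l, rfl⟩ := Nat.exists_eq_add_of_le hk
        simpa using glue_add (n : ℤ) y u l
    have hbd : ∀ n b, P.real {y | y n = b ∧ y 0 = x} ≤ ν.real {b} := fun n b => by
      rw [Measure.real, Measure.real, ← hP.measure_coord n b]
      exact ENNReal.toReal_mono (measure_ne_top _ _) (measure_mono fun y hy => hy.1)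
    have hlim : Tendsto (fun n : ℕ => ∑' b, (P.real {y | y n = b ∧ y 0 = x} -
        ν.real {x} * ν.real {b}) * h n b) atTop (𝓝 (∑' _ : E, 0)) := by
      refine tendsto_tsum_of_dominated_convergence (bound := fun b => 2 * ν.real {b} * C)
        ((hsumν.mul_left 2).mul_right C) (fun b => ?_) (Eventually.of_forall fun n b => ?_)
      · have h1 := (htail.tendsto_measure_pair hP x b).sub_const (ν.real {x} * ν.real {b})
        rw [sub_self] at h1
        refine h1.zero_mul_isBoundedUnder_le ?_
        exact isBoundedUnder_of ⟨C, fun n => hC n b⟩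
      · rw [norm_mul]
        have h1 : ν.real {x} ≤ 1 := measureReal_le_one
        have h2 := hbd n b
        have h3 : 0 ≤ P.real {y : ℤ → E | y n = b ∧ y 0 = x} := measureReal_nonneg
        have h4 : 0 ≤ ν.real {b} := measureReal_nonneg
        have h5 : 0 ≤ ν.real {x} := measureReal_nonneg
        refine mul_le_mul ?_ (hC n b) (norm_nonneg _) (by positivity)
        rw [Real.norm_eq_abs, abs_le]
        constructor <;> nlinarith
    rw [tsum_zero] at hlim
    have hlim2 := hlim.const_mul (ν.real {x})⁻¹
    rw [mul_zero] at hlim2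
    refine hlim2.congr fun n => ?_
    have s1 : Summable fun b => ν.real {b} * h n b := by
      refine (hsumν.mul_right C).of_norm_bounded fun b => ?_
      rw [norm_mul, Real.norm_of_nonneg measureReal_nonneg]
      exact mul_le_mul_of_nonneg_left (hC n b) measureReal_nonneg
    have s2 : Summable fun b => P.real {y : ℤ → E | y n = b ∧ y 0 = x} * h n b := by
      refine (hsumν.mul_right C).of_norm_bounded fun b => ?_
      rw [norm_mul, Real.norm_of_nonneg measureReal_nonneg]
      exact mul_le_mul (hbd n b) (hC n b) (norm_nonneg _) measureReal_nonneg
    have s3 : ∀ b, (P.real {y : ℤ → E | y n = b ∧ y 0 = x} - ν.real {x} * ν.real {b}) * h n b =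
        P.real {y : ℤ → E | y n = b ∧ y 0 = x} * h n b - ν.real {x} * (ν.real {b} * h n b) :=
      fun b => by ring
    rw [tsum_congr s3, s2.tsum_sub (s1.mul_left _), ← e1 n, e0, tsum_mul_left]
    field_simp
  have h1 := (key a ha).sub (key a' ha')
  rw [sub_zero] at h1
  have h2 : Tendsto (fun _ : ℕ => ∫ u, r u ∂(Q a) - ∫ u, r u ∂(Q a')) atTop (𝓝 0) :=
    h1.congr fun n => by ring
  exact sub_eq_zero.1 (tendsto_nhds_unique tendsto_const_nhds h2)

end Mixing

section Constant

variable {E : Type*} [Countable E] [MetricSpace E] [MeasurableSpace E] [DiscreteMeasurableSpace E]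
variable {κ : Kernel E E} [IsMarkovKernel κ] {ν : Measure E} [IsProbabilityMeasure ν]
  {P : Measure (ℤ → E)} [IsProbabilityMeasure P]

/-- A bounded function without coordinatewise oscillation is almost surely constant. -/
theorem ae_eq_integral_of_bounded_of_lipConst_eq_zero (hdisc : ∀ x y : E, x ≠ y → dist x y = 1)
    (hP : IsStationaryMarkov κ ν P) (htail : IsTailTrivial P) {Q : Kernel E (ℕ → E)}
    [IsMarkovKernel Q] (hQ : ∀ z, IsMarkovLaw κ (Measure.dirac z) (Q z)) {g : (ℤ → E) → ℝ}
    (hgm : Measurable g) {C : ℝ} (hgC : ∀ x, ‖g x‖ ≤ C) (hg : ∀ i, lipConst g i = 0) :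
    ∀ᵐ x ∂P, g x = ∫ y, g y ∂P := by
  have hgL : MemLp g 2 P := MemLp.of_bound hgm.aestronglyMeasurable C (ae_of_all _ hgC)
  have hgi : Integrable g P := hgL.integrable one_le_two
  have step : ∀ i : ℤ, P[g | pastSigma E i] =ᵐ[P] P[g | pastSigma E (i - 1)] := by
    intro i
    filter_upwards [(hP.condExp_self hQ i hgm hgi).2, (hP.condExp_pred hQ i hgm hgi).1,
      (hP.condExp_pred hQ i hgm hgi).2, hP.ae_coord_ne_zero i, hP.ae_coord_ne_zero (i - 1)]
      with x h1 h2 h3 h4 h5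
    rw [h1, h3, Kernel.integral_comp h2]
    have : ∀ᵐ z ∂(κ (x (i - 1))), ∫ u, g (glue i x u) ∂(Q z) = ∫ u, g (glue i x u) ∂(Q (x i)) := by
      filter_upwards [hP.ae_kernel_ne_zero h5] with z hz
      refine htail.integral_eq_of_remote hP hQ (hgm.comp ((measurable_glue i).comp
        (measurable_const.prodMk measurable_id))) (fun u => hgC _) (fun u v N huv => ?_) hz h4
      have h := enorm_sub_le_sum_lipConst hdisc g ((Finset.range N).image fun k : ℕ => i + k)
        (x := glue i x u) (y := glue i x v) fun j hj => by
          rcases lt_or_ge j i with h | h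
          · rw [glue_of_lt h, glue_of_lt h]
          · obtain ⟨k, rfl⟩ := Int.le.dest h
            rw [glue_add, glue_add]
            exact huv k (not_lt.1 fun hk => hj (Finset.mem_image.2 ⟨k, Finset.mem_range.2 hk, rfl⟩))
      simp only [hg, Finset.sum_const_zero, nonpos_iff_eq_zero, enorm_eq_zero] at h
      exact sub_eq_zero.1 h
    rw [integral_congr_ae this]
    simp
  have steps : ∀ (i : ℤ) (n : ℕ), P[g | pastSigma E (i + n)] =ᵐ[P] P[g | pastSigma E i] := by
    intro i n
    induction n with
    | zero => simp
    | succ n ih =>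
      have := step (i + (n + 1 : ℕ))
      rw [show i + ((n + 1 : ℕ) : ℤ) - 1 = i + n by push_cast; ring] at this
      exact this.trans ih
  obtain ⟨ns, hns⟩ := htail.exists_tendsto_sub hgm hgL
  have hall : ∀ᵐ x ∂P, ∀ n : ℕ, (P[g | pastSigma E n]) x = (P[g | pastSigma E (-n)]) x := by
    refine ae_all_iff.2 fun n => ?_
    have := steps (-n) (2 * n)
    rwa [show -(n : ℤ) + ((2 * n : ℕ) : ℤ) = n by push_cast; ring] at this
  filter_upwards [hns, hall] with x h1 h2
  have h3 : Tendsto (fun _ : ℕ => (0 : ℝ)) atTop (𝓝 (g x - ∫ y, g y ∂P)) :=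
    h1.congr fun k => by rw [h2, sub_self]
  exact sub_eq_zero.1 (tendsto_nhds_unique h3 tendsto_const_nhds)

/-- A function without coordinatewise oscillation is almost surely constant: pass to the bounded
function `arctan ∘ f`. -/
theorem ae_eq_integral_of_lipConst_eq_zero (hdisc : ∀ x y : E, x ≠ y → dist x y = 1)
    (hP : IsStationaryMarkov κ ν P) (htail : IsTailTrivial P) {Q : Kernel E (ℕ → E)}
    [IsMarkovKernel Q] (hQ : ∀ z, IsMarkovLaw κ (Measure.dirac z) (Q z)) {f : (ℤ → E) → ℝ}
    (hfm : Measurable f) (hf : ∀ i, lipConst f i = 0) : ∀ᵐ x ∂P, f x = ∫ y, f y ∂P := by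
  have h1 := ae_eq_integral_of_bounded_of_lipConst_eq_zero (g := fun x => Real.arctan (f x))
    (C := Real.pi / 2) hdisc hP htail hQ (Real.continuous_arctan.measurable.comp hfm) (fun x => by
      rw [Real.norm_eq_abs, abs_le]
      exact ⟨(Real.neg_pi_div_two_lt_arctan _).le, (Real.arctan_lt_pi_div_two _).le⟩) (fun i => by
      simp only [lipConst, ENNReal.iSup_eq_zero]
      intro x y hxy hne
      have := enorm_sub_le_lipConst hdisc f hxy
      rw [hf i, nonpos_iff_eq_zero, enorm_eq_zero, sub_eq_zero] at this
      simp [this])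
  have h2 : ∀ᵐ x ∂P, f x = Real.tan (∫ y, Real.arctan (f y) ∂P) := by
    filter_upwards [h1] with x hx
    rw [← hx, Real.tan_arctan]
  have h3 : ∫ y, f y ∂P = Real.tan (∫ y, Real.arctan (f y) ∂P) := by
    rw [integral_congr_ae h2]; simp
  rwa [h3]

end Constant

/-! ### The moment bound -/

/-- The weighted sum `∑ k, δ_{i+k}(f)² (k + 1)^{-(1+ε)}` of the squared Lipschitz constants at the
times from `i` on. -/
noncomputable def futureLip {E : Type*} [MetricSpace E] (ε : ℝ) (f : (ℤ → E) → ℝ) (i : ℤ) : ℝ≥0∞ :=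
  ∑' k : ℕ, lipConst f (i + k) ^ 2 * (1 / ((k : ℝ≥0∞) + 1)) ^ (1 + ε)

theorem tsum_futureLip {E : Type*} [MetricSpace E] (ε : ℝ) (f : (ℤ → E) → ℝ) :
    ∑' i, futureLip ε f i = zetaSum (1 + ε) * ∑' i, lipConst f i ^ 2 := by
  simp only [futureLip]
  rw [ENNReal.tsum_comm, zetaSum, ← ENNReal.tsum_mul_right]
  refine tsum_congr fun k => ?_
  rw [ENNReal.tsum_mul_right, mul_comm]
  congr 1
  exact (Equiv.addRight (k : ℤ)).tsum_eq fun i => lipConst f i ^ 2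

theorem momentConst_eq_top {E : Type*} [MeasurableSpace E] {κ : Kernel E E} {ν : Measure E}
    {Phat : E → E → Measure ((ℕ → E) × (ℕ → E))} {ε : ℝ} {p : ℕ} (hp : 1 ≤ p)
    (h : ∑' (a : E) (b : E), ν {a} * κ a {b} * jumpMoment κ Phat ε a b ^ (2 * p) = ∞) :
    momentConst κ ν Phat ε p = ∞ := by
  have hp1 : (1 : ℝ) ≤ p := by exact_mod_cast hp
  have e : momentConst κ ν Phat ε p = ENNReal.ofReal ((2 * (p : ℝ) - 1) ^ (2 * p)) *
      (zetaSum (1 + ε) / 2) ^ p *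
        ∑' (a : E) (b : E), ν {a} * κ a {b} * jumpMoment κ Phat ε a b ^ (2 * p) := rfl
  have hz : zetaSum (1 + ε) ≠ 0 := fun h0 => by
    have := ENNReal.tsum_eq_zero.1 h0 0
    simp at this
  rw [e, h]
  refine ENNReal.mul_top (mul_ne_zero ?_ (pow_ne_zero _ (ENNReal.div_ne_zero.2 ⟨hz, by simp⟩)))
  exact (ENNReal.ofReal_pos.2 (pow_pos (by linarith) _)).ne'

theorem l2norm_pow (a : ℤ → ℝ≥0∞) (p : ℕ) : l2norm a ^ (2 * p) = (∑' i, a i ^ 2) ^ p := by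
  rw [l2norm, pow_mul, ← ENNReal.rpow_two, ← ENNReal.rpow_mul]
  norm_num

section MomentBound

variable {E : Type*} [Countable E] [MetricSpace E] [MeasurableSpace E] [DiscreteMeasurableSpace E]
variable {κ : Kernel E E} [IsMarkovKernel κ] {ν : Measure E}
  {P : Measure (ℤ → E)} [IsProbabilityMeasure P]
  {Phat : E → E → Measure ((ℕ → E) × (ℕ → E))}

/-- The bound on the martingale increment at time `i`. It needs a finite moment, for otherwise the
two coupled trajectories may differ at infinitely many times, which the Lipschitz constants do not
control. -/
theorem ae_enorm_condExp_sub_sq_le (hdisc : ∀ x y : E, x ≠ y → dist x y = 1)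
    (hP : IsStationaryMarkov κ ν P) (hPhat : IsChainCoupling κ Phat) {ε : ℝ} (hε : 0 < ε)
    {f : (ℤ → E) → ℝ} (hfm : Measurable f) (hf : Integrable f P) (i : ℤ) :
    ∀ᵐ x ∂P, jumpMoment κ Phat ε (x (i - 1)) (x i) ≠ ∞ →
      ‖(P[f | pastSigma E i]) x - (P[f | pastSigma E (i - 1)]) x‖ₑ ^ 2 ≤
        futureLip ε f i * (1 / 2 * jumpMoment κ Phat ε (x (i - 1)) (x i) ^ 2) := by
  filter_upwards [condExp_sub_eq_integral hP hPhat hfm hf i] with x hx hfin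
  set ρ := jumpCoupling κ Phat (x (i - 1)) (x i) with hρ
  have := hPhat.isMarkovKernel_couplingKernel (x i)
  have : IsProbabilityMeasure ρ := by rw [hρ, jumpCoupling]; infer_instance
  have hT : Measurable (couplingTime : (ℕ → E) × (ℕ → E) → ℕ∞) := measurable_couplingTime
  have hS : ∀ k : ℕ, MeasurableSet {w : (ℕ → E) × (ℕ → E) | (k : ℕ∞) < couplingTime w} :=
    fun k => hT (.of_discrete (s := Set.Ioi (k : ℕ∞)))
  have hI : ∀ k : ℕ, Measurable ({w : (ℕ → E) × (ℕ → E) | (k : ℕ∞) < couplingTime w}.indicator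
      (1 : (ℕ → E) × (ℕ → E) → ℝ≥0∞)) := fun k => measurable_one.indicator (hS k)
  have h1 : ‖(P[f | pastSigma E i]) x - (P[f | pastSigma E (i - 1)]) x‖ₑ ≤
      ∑' k : ℕ, lipConst f (i + k) * ρ {w | (k : ℕ∞) < couplingTime w} := by
    rw [hx]
    refine (enorm_integral_le_lintegral_enorm _).trans ?_
    calc _ ≤ ∫⁻ w, ∑' k : ℕ, lipConst f (i + k) *
          {w : (ℕ → E) × (ℕ → E) | (k : ℕ∞) < couplingTime w}.indicator 1 w ∂ρ := by
          refine lintegral_mono_ae ?_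
          filter_upwards [ae_couplingTime_ne_top hε hfin] with w hw
          exact enorm_sub_glue_le hdisc f i x hw
      _ = _ := by
          rw [lintegral_tsum fun k => ((hI k).const_mul _).aemeasurable]
          refine tsum_congr fun k => ?_
          rw [lintegral_const_mul _ (hI k), lintegral_indicator_one (hS k)]
  calc _ ≤ (∑' k : ℕ, lipConst f (i + k) * ρ {w | (k : ℕ∞) < couplingTime w}) ^ 2 := by gcongr
    _ ≤ _ := tsum_mul_measure_sq_le ρ hT hε.le _
    _ = _ := by rw [hρ, lintegral_jumpCoupling]; rfl

/-- The squared `L^{2p}` norm of the increment at time `i`: the deterministic factor depends on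
`i`, while the random factor is a function of `(X_{i-1}, X_i)` with a law that does not. -/
theorem moment_condExp_sub_le (hdisc : ∀ x y : E, x ≠ y → dist x y = 1)
    (hP : IsStationaryMarkov κ ν P) (hPhat : IsChainCoupling κ Phat) {ε : ℝ} (hε : 0 < ε)
    {f : (ℤ → E) → ℝ} (hfm : Measurable f) (hf : Integrable f P) {p : ℕ} (hp : 1 ≤ p)
    (hfin : ∑' (a : E) (b : E), ν {a} * κ a {b} * jumpMoment κ Phat ε a b ^ (2 * p) ≠ ∞) (i : ℤ) :
    (∫⁻ x, ENNReal.ofReal (((P[f | pastSigma E i]) x - (P[f | pastSigma E (i - 1)]) x) ^ (2 * p)) ∂P)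
        ^ (1 / (p : ℝ)) ≤
      futureLip ε f i * (1 / 2 * (∑' (a : E) (b : E),
        ν {a} * κ a {b} * jumpMoment κ Phat ε a b ^ (2 * p)) ^ (1 / (p : ℝ))) := by
  have hp0 : (0 : ℝ) < p := by exact_mod_cast hp
  have hlp := hP.lintegral_pair i fun a b => jumpMoment κ Phat ε a b ^ (2 * p)
  have hm : Measurable fun x : ℤ → E => jumpMoment κ Phat ε (x (i - 1)) (x i) ^ (2 * p) :=
    (measurable_of_countable fun q : E × E => jumpMoment κ Phat ε q.1 q.2 ^ (2 * p)).comp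
      (by fun_prop : Measurable fun x : ℤ → E => (x (i - 1), x i))
  rw [← hlp] at hfin ⊢
  have hae : ∀ᵐ x ∂P, jumpMoment κ Phat ε (x (i - 1)) (x i) ≠ ∞ := by
    filter_upwards [ae_lt_top hm hfin] with x hx h
    rw [h, ENNReal.top_pow (by omega)] at hx
    exact lt_irrefl _ hx
  calc _ ≤ (∫⁻ x, (futureLip ε f i * (1 / 2)) ^ p *
        jumpMoment κ Phat ε (x (i - 1)) (x i) ^ (2 * p) ∂P) ^ (1 / (p : ℝ)) := by
        refine ENNReal.rpow_le_rpow (lintegral_mono_ae ?_) (by positivity)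
        filter_upwards [hae, ae_enorm_condExp_sub_sq_le hdisc hP hPhat hε hfm hf i] with x h1 h2
        have h3 := pow_le_pow_left₀ zero_le (h2 h1) p
        rw [← mul_assoc, mul_pow, ← pow_mul, ← pow_mul] at h3
        refine le_trans (le_of_eq ?_) h3
        rw [← enorm_pow, Real.enorm_of_nonneg ((even_two_mul p).pow_nonneg _)]
    _ = _ := by
        rw [lintegral_const_mul _ hm, ENNReal.mul_rpow_of_nonneg _ _ (by positivity),
          ← ENNReal.rpow_natCast, ← ENNReal.rpow_mul, mul_one_div_cancel hp0.ne', ENNReal.rpow_one,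
          mul_assoc]

/-- The moment bound in the case where the series in `momentConst` converges. -/
theorem moment_le_of_finite (hdisc : ∀ x y : E, x ≠ y → dist x y = 1)
    (hP : IsStationaryMarkov κ ν P) (htail : IsTailTrivial P) (hPhat : IsChainCoupling κ Phat)
    {ε : ℝ} (hε : 0 < ε) {f : (ℤ → E) → ℝ} (hfm : Measurable f) {p : ℕ} (hp : 1 ≤ p)
    (hfLp : MemLp f (2 * (p : ℝ≥0∞)) P)
    (hfin : ∑' (a : E) (b : E), ν {a} * κ a {b} * jumpMoment κ Phat ε a b ^ (2 * p) ≠ ∞) :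
    ∫⁻ x, ENNReal.ofReal ((f x - ∫ y, f y ∂P) ^ (2 * p)) ∂P ≤
      momentConst κ ν Phat ε p * (∑' i, lipConst f i ^ 2) ^ p := by
  have hp0 : (0 : ℝ) < p := by exact_mod_cast hp
  have hp1 : (1 : ℝ≥0∞) ≤ p := by exact_mod_cast hp
  have hf2 : MemLp f 2 P := hfLp.mono_exponent (le_mul_of_one_le_right zero_le hp1)
  have hfi : Integrable f P := hf2.integrable one_le_two
  have h12p : (1 : ℝ≥0∞) ≤ 2 * p := one_le_two.trans (le_mul_of_one_le_right zero_le hp1)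
  set S := ∑' (a : E) (b : E), ν {a} * κ a {b} * jumpMoment κ Phat ε a b ^ (2 * p) with hS
  set s : ℝ≥0∞ := ENNReal.ofReal ((2 * p - 1) ^ 2) with hs
  set B : ℝ≥0∞ := s * (zetaSum (1 + ε) * (∑' i, lipConst f i ^ 2) *
    (1 / 2 * S ^ (1 / (p : ℝ)))) with hB
  -- The martingale between the times `-n` and `n`.
  have key : ∀ n : ℕ, ∫⁻ x, ENNReal.ofReal (((P[f | pastSigma E n]) x -
      (P[f | pastSigma E (-n)]) x) ^ (2 * p)) ∂P ≤ B ^ p := by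
    intro n
    have h := martingale_moment_le hp (G := fun k : ℕ => pastSigma E (-n + k))
      (M := fun k : ℕ => P[f | pastSigma E (-n + k)] - P[f | pastSigma E (-n)])
      (fun k => pastSigma_le _) (by simp)
      (fun k => (hfLp.condExp h12p).sub (hfLp.condExp h12p))
      (fun k => stronglyMeasurable_condExp.sub
        (stronglyMeasurable_condExp.mono (pastSigma_mono (by omega))))
      (fun k => ?_)
      (β := fun k : ℕ => futureLip ε f (-n + (k + 1 : ℕ)) * (1 / 2 * S ^ (1 / (p : ℝ))))
      (fun k => ?_) (2 * n)
    · have h2 : (∫⁻ x, ENNReal.ofReal (((P[f | pastSigma E n]) x -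
          (P[f | pastSigma E (-n)]) x) ^ (2 * p)) ∂P) ^ (1 / (p : ℝ)) ≤ B := by
        rw [show -(n : ℤ) + ((2 * n : ℕ) : ℤ) = n by push_cast; ring] at h
        refine h.trans ?_
        rw [hB, ← Finset.sum_mul]
        gcongr
        rw [← tsum_futureLip]
        have inj : Function.Injective fun k : ℕ => -(n : ℤ) + (k + 1 : ℕ) := fun a b hab => by
          simpa using hab
        exact (ENNReal.sum_le_tsum _).trans (ENNReal.tsum_comp_le_tsum_of_injective inj _)
      have h3 := pow_le_pow_left₀ zero_le h2 p
      rwa [← ENNReal.rpow_natCast, ← ENNReal.rpow_mul, one_div_mul_cancel hp0.ne',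
        ENNReal.rpow_one] at h3
    · have e : P[f | pastSigma E (-n + (k + 1 : ℕ))] - P[f | pastSigma E (-n)] -
          (P[f | pastSigma E (-n + k)] - P[f | pastSigma E (-n)]) =
          P[f | pastSigma E (-n + (k + 1 : ℕ))] - P[f | pastSigma E (-n + k)] := by abel
      rw [e]
      have hle : pastSigma E (-n + k) ≤ pastSigma E (-n + (k + 1 : ℕ)) :=
        pastSigma_mono (by push_cast; omega)
      refine (condExp_sub integrable_condExp integrable_condExp _).trans ?_
      have h1 := condExp_condExp_of_le (μ := P) (f := f) hle (pastSigma_le _)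
      have h2 : P[P[f | pastSigma E (-n + k)] | pastSigma E (-n + k)] =
          P[f | pastSigma E (-n + k)] :=
        condExp_of_stronglyMeasurable (pastSigma_le _) stronglyMeasurable_condExp
          integrable_condExp
      filter_upwards [h1] with x hx
      rw [Pi.sub_apply, hx, h2, sub_self]; rfl
    · have h := moment_condExp_sub_le hdisc hP hPhat hε hfm hfi hp hfin (-n + (k + 1 : ℕ))
      rw [show -(n : ℤ) + ((k + 1 : ℕ) : ℤ) - 1 = -n + k by push_cast; ring] at h
      simpa only [Pi.sub_apply, sub_sub_sub_cancel_right] using h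
  obtain ⟨ns, hns⟩ := htail.exists_tendsto_sub hfm hf2
  have hcont : Continuous fun t : ℝ => ENNReal.ofReal (t ^ (2 * p)) :=
    ENNReal.continuous_ofReal.comp (continuous_pow _)
  calc _ = ∫⁻ x, liminf (fun k => ENNReal.ofReal (((P[f | pastSigma E (ns k)]) x -
          (P[f | pastSigma E (-(ns k))]) x) ^ (2 * p))) atTop ∂P := by
        refine lintegral_congr_ae ?_
        filter_upwards [hns] with x hx
        exact ((hcont.tendsto _).comp hx).liminf_eq.symm
    _ ≤ liminf (fun k => ∫⁻ x, ENNReal.ofReal (((P[f | pastSigma E (ns k)]) x -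
          (P[f | pastSigma E (-(ns k))]) x) ^ (2 * p)) ∂P) atTop := by
        refine lintegral_liminf_le' fun k => ?_
        exact hcont.measurable.comp_aemeasurable
          (((stronglyMeasurable_condExp.mono (pastSigma_le _)).measurable.sub
            (stronglyMeasurable_condExp.mono (pastSigma_le _)).measurable).aemeasurable)
    _ ≤ B ^ p := liminf_le_of_le (by isBoundedDefault) fun b hb => by
        obtain ⟨k, hk⟩ := hb.exists
        exact hk.trans (key _)
    _ = _ := by
        have e1 : (S ^ (1 / (p : ℝ))) ^ p = S := by
          rw [← ENNReal.rpow_natCast, ← ENNReal.rpow_mul, one_div_mul_cancel hp0.ne',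
            ENNReal.rpow_one]
        have e2 : s ^ p = ENNReal.ofReal ((2 * (p : ℝ) - 1) ^ (2 * p)) := by
          rw [hs, ← ENNReal.ofReal_pow (sq_nonneg _), ← pow_mul]
        have e3 : momentConst κ ν Phat ε p = s ^ p * (zetaSum (1 + ε) / 2) ^ p * S := by
          rw [e2]; rfl
        rw [e3, hB]
        rw [mul_pow, mul_pow, mul_pow, mul_pow, e1, one_div, div_eq_mul_inv, mul_pow]
        ring

/-- The moment bound, including the case of an infinite constant. -/
theorem moment_le [IsProbabilityMeasure ν] (hdisc : ∀ x y : E, x ≠ y → dist x y = 1)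
    (hP : IsStationaryMarkov κ ν P) (htail : IsTailTrivial P) (hPhat : IsChainCoupling κ Phat)
    {ε : ℝ} (hε : 0 < ε) {f : (ℤ → E) → ℝ} (hfm : Measurable f) {p : ℕ} (hp : 1 ≤ p)
    (hfLp : MemLp f (2 * (p : ℝ≥0∞)) P) :
    ∫⁻ x, ENNReal.ofReal ((f x - ∫ y, f y ∂P) ^ (2 * p)) ∂P ≤
      momentConst κ ν Phat ε p * l2norm (lipConst f) ^ (2 * p) := by
  rw [l2norm_pow]
  by_cases hfin : ∑' (a : E) (b : E), ν {a} * κ a {b} * jumpMoment κ Phat ε a b ^ (2 * p) = ∞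
  · by_cases hδ : ∀ i, lipConst f i = 0
    · -- The right-hand side is `∞ * 0 = 0`, so the claim is that `f` is almost surely constant.
      have := hPhat.isMarkovKernel_chainKernel
      have hconst := ae_eq_integral_of_lipConst_eq_zero hdisc hP htail
        hPhat.isMarkovLaw_chainKernel hfm hδ
      refine le_trans (le_of_eq ?_) zero_le
      rw [lintegral_congr_ae (g := fun _ => 0), lintegral_zero]
      filter_upwards [hconst] with x hx
      rw [hx, sub_self, zero_pow (by omega), ENNReal.ofReal_zero]
    · rw [momentConst_eq_top hp hfin, ENNReal.top_mul]
      · exact le_top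
      · push Not at hδ
        obtain ⟨i, hi⟩ := hδ
        refine pow_ne_zero _ fun h0 => hi ?_
        simpa using ENNReal.tsum_eq_zero.1 h0 i
  · exact moment_le_of_finite hdisc hP htail hPhat hε hfm hp hfLp hfin

end MomentBound

end MarkovConcentration

theorem theorem2 {E : Type*} [Countable E] [MetricSpace E] [MeasurableSpace E]
    [DiscreteMeasurableSpace E]
    (hdisc : ∀ x y : E, x ≠ y → dist x y = 1)
    (κ : Kernel E E) [IsMarkovKernel κ]
    (ν : Measure E) [IsProbabilityMeasure ν]
    (P : Measure (ℤ → E)) [IsProbabilityMeasure P]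
    (hP : MarkovConcentration.IsStationaryMarkov κ ν P)
    (htail : MarkovConcentration.IsTailTrivial P)
    (Phat : E → E → Measure ((ℕ → E) × (ℕ → E)))
    (hPhat : MarkovConcentration.IsChainCoupling κ Phat)
    (p : ℕ) (hp : 1 ≤ p)
    (f : (ℤ → E) → ℝ) (hfm : Measurable f)
    (hfLip : MarkovConcentration.IsLipCoord f)
    (hfLp : MemLp f (2 * (p : ℝ≥0∞)) P)
    (ε : ℝ) (hε : 0 < ε) :
    (∫⁻ x, ENNReal.ofReal ((f x - ∫ y, f y ∂P) ^ (2 * p)) ∂P ≤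
      MarkovConcentration.momentConst κ ν Phat ε p *
        MarkovConcentration.l2norm (MarkovConcentration.lipConst f) ^ (2 * p)) ∧
    ∀ t : ℝ, 0 < t →
      P {x | t ≤ |f x - ∫ y, f y ∂P|} ≤
        MarkovConcentration.momentConst κ ν Phat ε p *
          (MarkovConcentration.l2norm (MarkovConcentration.lipConst f) ^ (2 * p) /
            ENNReal.ofReal (t ^ (2 * p))) := by
  have moment := MarkovConcentration.moment_le hdisc hP htail hPhat hε hfm hp hfLp
  refine ⟨moment, fun t ht => ?_⟩
  have htp : 0 < t ^ (2 * p) := pow_pos ht _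
  rw [← mul_div_assoc]
  calc P {x | t ≤ |f x - ∫ y, f y ∂P|}
      ≤ P {x | ENNReal.ofReal (t ^ (2 * p)) ≤ ENNReal.ofReal ((f x - ∫ y, f y ∂P) ^ (2 * p))} := by
        refine measure_mono fun x (hx : t ≤ |f x - ∫ y, f y ∂P|) => ?_
        refine ENNReal.ofReal_le_ofReal ?_
        rw [← (even_two_mul p).pow_abs (f x - _)]
        exact pow_le_pow_left₀ ht.le hx _
    _ ≤ (∫⁻ x, ENNReal.ofReal ((f x - ∫ y, f y ∂P) ^ (2 * p)) ∂P) /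
          ENNReal.ofReal (t ^ (2 * p)) :=
        meas_ge_le_lintegral_div (by fun_prop) (ENNReal.ofReal_pos.2 htp).ne' ENNReal.ofReal_ne_top
    _ ≤ _ := by gcongr
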